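/- Let $\varphi=\frac{1+\sqrt5}{2}$, let $e_1,\dots,e_8$ be the standard basis of $\mathbb R^8$, and let $P=\operatorname{conv}(v_0,\dots,v_{11})\subset\mathbb R^8$ be the Perles polytope, where \[ v_0=0,\quad v_1=e_1,\ v_2=e_2,\ v_3=e_3,\ v_4=e_4,\quad v_8=e_5,\ v_9=e_6,\ v_{10}=e_7,\ v_{11}=e_8, \] \[ v_5=(\varphi-2,\,2-\varphi,\,2-\varphi,\,\varphi-2,\,1,\,0,\,0,\,2\varphi-3),\quad v_6=(1,-1,0,1-\varphi,0,\varphi,0,1),\quad v_7=(-\varphi,-1,-\varphi-1,1,0,0,\varphi+1,1). \] A \emph{realization} of $P$ is a polytope $Q\subset\mathbb R^8$ whose face lattice is isomorphic to that of $P$; it is \emph{rational} if all its vertices have rational coordinates. A slack matrix of $Q$ for a list of facets has as its rows the vertices $w_i$ and as its columns the facets $G_j$, with entries $b_j-\alpha_j^\top w_i$, where $b_j-\alpha_j^\top x\ge 0$ is valid on $Q$ and holds with equality exactly on $G_j$; the symbolic slack matrix is obtained by replacing the nonzero entries by distinct variables. Then the following hold. 1. $P$ is a projectively unique $8$-polytope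 (every realization of $P$ is the image of $P$ under a projective transformation defined on $P$) with exactly the $12$ vertices $v_0,\dots,v_{11}$ and with $34$ facets; there are $120$ pairs of a vertex and a facet not containing it, so the symbolic slack matrix of $P$ is a $12\times 34$ matrix with $120$ variables. 2. $P$ has exactly $13$ nonsimplicial facets $F_0,\dots,F_{12}$. They contain a flag: some maximal chain of the face lattice of $P$ consists of intersections of these facets. In a suitable order, their symbolic slack matrix, with rows indexed by $v_0,\dots,v_{11}$, is \[ S_F(x)=\begin{bmatrix} 0 & 0 & 0 & x_0 & x_1 & x_2 & 0 & 0 & 0 & 0 & 0 & 0 & 0\\ 0 & 0 & 0 & x_3 & 0 & 0 & x_4 & x_5 & x_6 & 0 & 0 & 0 & 0\\ 0 & 0 & 0 & 0 & 0 & 0 & x_7 & 0 & 0 & x_8 & x_9 & 0 & 0\\ 0 & 0 & 0 & 0 & x_{10} & 0 & 0 & 0 & 0 & 0 & 0 & x_{11} & x_{12}\\ 0 & 0 & 0 & 0 & 0 & 0 & 0 & x_{13} & 0 & x_{14} & 0 & x_{15} & 0\\ x_{16} & 0 & 0 & 0 & 0 & 0 & 0 & 0 & 0 & 0 & x_{17}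 & 0 & x_{18}\\ 0 & x_{19} & 0 & 0 & 0 & 0 & 0 & 0 & x_{20} & 0 & 0 & 0 & 0\\ 0 & 0 & x_{21} & 0 & 0 & x_{22} & 0 & 0 & 0 & 0 & 0 & 0 & 0\\ x_{23} & 0 & 0 & x_{24} & 0 & 0 & 0 & x_{25} & 0 & 0 & 0 & 0 & 0\\ 0 & x_{26} & 0 & 0 & x_{27} & 0 & 0 & 0 & 0 & x_{28} & 0 & 0 & 0\\ 0 & 0 & x_{29} & 0 & 0 & 0 & x_{30} & 0 & 0 & 0 & 0 & 0 & x_{31}\\ 0 & 0 & 0 & 0 & 0 & x_{32} & 0 & 0 & x_{33} & 0 & x_{34} & x_{35} & 0 \end{bmatrix}. \] The entries $x_i$ with $i\in\Phi=\{0,3,4,5,6,7,8,9,12,14,15,16,17,20,21,25,26,27,28,29,30,31,32,34\}$ form a maximal spanning forest of the non-incidence graph of $S_F$, the bipartite graph on the $12$ rows and $13$ columns whose edges are the nonzero entries. 3. Let $k$ be a field and set $x_i=1$ in $S_F(x)$ for all $i\in\Phi$. The scaled reduced slack ideal, that is, the ideal of $k[x_i: i\notin\Phi]$ generated by the $10$-minors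 of this matrix and saturated with respect to the product of all remaining variables, equals \[ \langle x_{35}^2+x_{35}-1,\ x_{33}-x_{35}-1,\ x_{24}-x_{35},\ x_{23}-x_{35},\ x_{22}-1,\ x_{19}-x_{35},\ x_{18}-x_{35},\ x_{13}-x_{35}-1,\ x_{11}-x_{35},\ x_{10}-1,\ x_2-1,\ x_1-x_{35}-1\rangle . \] In particular, every complex zero of this ideal (for $k=\mathbb C$) has $x_{35}=\frac{-1\pm\sqrt5}{2}$. 4. Let $Q$ be a realization of $P$, with vertices $w_i$ and facets $G_j$ corresponding to $v_i$ and $F_j$ under an isomorphism of face lattices. Every slack matrix of $Q$ for $w_0,\dots,w_{11}$ and $G_0,\dots,G_{12}$ can be scaled, by positive row and column factors, to a matrix $S_F(a)$ with real $a$ and $a_i=1$ for all $i\in\Phi$; and whenever it is scaled by nonzero row and column factors to such a matrix $S_F(a)$, then $a_{35}=\frac{-1\pm\sqrt5}{2}$. 5. $P$ has no rational realization. -/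

import Mathlib

noncomputable section

namespace SlackModel

/-! ### Polytopes, faces, realizations -/

/-- A (convex) polytope in `ℝ^d`: the convex hull of a finite set of points. -/
def IsPolytope {d : ℕ} (Q : Set (Fin d → ℝ)) : Prop :=
  ∃ T : Set (Fin d → ℝ), T.Finite ∧ Q = convexHull ℝ T

/-- The face lattice of `Q`: the empty set and all subsets of `Q` on which some linear functional
attains its maximum over `Q` (the zero functional gives `Q` itself), ordered by inclusion. -/
abbrev Face {d : ℕ} (Q : Set (Fin d → ℝ)) : Type :=
  {B : Set (Fin d → ℝ) // IsExposed ℝ Q B}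

/-- Facets: the maximal proper faces. -/
def IsFacet {d : ℕ} (Q B : Set (Fin d → ℝ)) : Prop :=
  Maximal (fun A => IsExposed ℝ Q A ∧ A ≠ Q) B

/-- A polytope is a simplex if its vertices are affinely independent. -/
def IsSimplex {d : ℕ} (B : Set (Fin d → ℝ)) : Prop :=
  AffineIndependent ℝ ((↑) : B.extremePoints ℝ → (Fin d → ℝ))

/-- Combinatorial equivalence: isomorphic face lattices.  The polytopes in `ℝ^d` that are
combinatorially equivalent to a `d`-polytope `P` are the realizations of `P`. -/
def CombEquiv {d : ℕ} (P Q : Set (Fin d → ℝ)) : Prop :=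
  Nonempty (Face P ≃o Face Q)

/-- All vertices have rational coordinates. -/
def IsRational {d : ℕ} (Q : Set (Fin d → ℝ)) : Prop :=
  ∀ x ∈ Q.extremePoints ℝ, ∀ i, ∃ q : ℚ, x i = (q : ℝ)

/-- Homogeneous coordinates `(x, 1)` of a point. -/
def homog {d : ℕ} (x : Fin d → ℝ) : Fin d ⊕ Unit → ℝ :=
  Sum.elim x (fun _ => 1)

/-- `Q` is the image of `P` under a projective transformation that is defined (that is, has
positive denominator) on all of `P`. -/
def ProjEquiv {d : ℕ} (P Q : Set (Fin d → ℝ)) : Prop :=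
  ∃ M : Matrix (Fin d ⊕ Unit) (Fin d ⊕ Unit) ℝ, IsUnit M.det ∧
    (∀ x ∈ P, 0 < M.mulVec (homog x) (Sum.inr ())) ∧
    Q = (fun x i => M.mulVec (homog x) (Sum.inl i) / M.mulVec (homog x) (Sum.inr ())) '' P

/-- Every realization is projectively equivalent to `P`. -/
def IsProjectivelyUnique {d : ℕ} (P : Set (Fin d → ℝ)) : Prop :=
  ∀ Q : Set (Fin d → ℝ), IsPolytope Q → CombEquiv P Q → ProjEquiv P Q

/-- The faces `F j` contain a flag: some maximal chain of the face lattice of `P` consists of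
intersections of members of the family (the empty intersection being `P`). -/
def ContainsFlag {d : ℕ} {κ : Type*} (P : Set (Fin d → ℝ)) (F : κ → Face P) : Prop :=
  ∃ c : Flag (Face P), ∀ B ∈ c, ∃ T : Set κ, (B : Set (Fin d → ℝ)) = P ∩ ⋂ j ∈ T, (F j).1

/-! ### Slack matrices and slack ideals -/

/-- `S` is a slack matrix of `Q` for the points `v i` and the faces `F j`: the entry `(i, j)` is
`b j - ⟨α j, v i⟩`, where `b j - ⟨α j, x⟩ ≥ 0` is valid on `Q` and defines the face `F j`. -/
def IsSlackMatrix {d : ℕ} {ι κ : Type*} (Q : Set (Fin d → ℝ)) (v : ι → Fin d → ℝ)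
    (F : κ → Set (Fin d → ℝ)) (S : Matrix ι κ ℝ) : Prop :=
  ∃ (b : κ → ℝ) (α : κ → Fin d → ℝ),
    (∀ j, ∀ x ∈ Q, 0 ≤ b j - α j ⬝ᵥ x) ∧
    (∀ j, F j = {x ∈ Q | b j - α j ⬝ᵥ x = 0}) ∧
    ∀ i j, S i j = b j - α j ⬝ᵥ v i

/-- `S` is the symbolic slack matrix for the points `v i` and the faces `F j`, in the variables
`σ`: it is zero at the incident pairs, and the non-incident pairs carry the distinct variables,
each variable being used. -/
def IsSymbolicSlackMatrix {d : ℕ} {ι κ σ k : Type*} [Field k] (v : ι → Fin d → ℝ)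
    (F : κ → Set (Fin d → ℝ)) (S : Matrix ι κ (MvPolynomial σ k)) : Prop :=
  (∀ i j, v i ∈ F j → S i j = 0) ∧
  ∃ e : {p : ι × κ // v p.1 ∉ F p.2} ≃ σ, ∀ p, S p.1.1 p.1.2 = MvPolynomial.X (e p)

/-- The saturation `I : f^∞`. -/
def saturateBy {R : Type*} [CommRing R] (I : Ideal R) (f : R) : Ideal R where
  carrier := {p | ∃ n : ℕ, f ^ n * p ∈ I}
  zero_mem' := ⟨0, by simp⟩
  add_mem' := by
    rintro p q ⟨m, hm⟩ ⟨n, hn⟩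
    refine ⟨m + n, ?_⟩
    have h : f ^ (m + n) * (p + q) = f ^ n * (f ^ m * p) + f ^ m * (f ^ n * q) := by ring
    rw [h]
    exact I.add_mem (I.mul_mem_left _ hm) (I.mul_mem_left _ hn)
  smul_mem' := by
    rintro c p ⟨n, hn⟩
    refine ⟨n, ?_⟩
    have h : f ^ n * (c • p) = c * (f ^ n * p) := by rw [smul_eq_mul]; ring
    rw [h]
    exact I.mul_mem_left _ hn

/-- The ideal generated by the `m`-minors of `S` (minors up to sign: the chosen rows and columns
need not be listed in increasing order). -/
def minorsIdeal {ι κ R : Type*} [CommRing R] (m : ℕ) (S : Matrix ι κ R) : Ideal R :=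
  Ideal.span {p | ∃ (r : Fin m ↪ ι) (c : Fin m ↪ κ), p = (S.submatrix r c).det}

/-- The slack ideal of a (possibly scaled) symbolic slack matrix in dimension `d`: the ideal of its
`(d+2)`-minors, saturated by the product of all variables. -/
def slackIdeal {ι κ σ k : Type*} [Fintype σ] [Field k] (d : ℕ)
    (S : Matrix ι κ (MvPolynomial σ k)) : Ideal (MvPolynomial σ k) :=
  saturateBy (minorsIdeal (d + 2) S) (∏ n : σ, MvPolynomial.X n)

/-- The bipartite graph on rows and columns whose edges are the pairs with `r i j`. -/
def bipartiteGraph {ι κ : Type*} (r : ι → κ → Prop) : SimpleGraph (ι ⊕ κ) :=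
  SimpleGraph.fromRel fun a b => ∃ i j, a = Sum.inl i ∧ b = Sum.inr j ∧ r i j

/-- The non-incidence graph of the points `v i` and the faces `F j`. -/
def nonIncidenceGraph {d : ℕ} {ι κ : Type*} (v : ι → Fin d → ℝ)
    (F : κ → Set (Fin d → ℝ)) : SimpleGraph (ι ⊕ κ) :=
  bipartiteGraph fun i j => v i ∉ F j

/-- `T` is a maximal spanning forest of `G`. -/
def IsMaximalForest {V : Type*} (G T : SimpleGraph V) : Prop :=
  Maximal (fun H => H ≤ G ∧ H.IsAcyclic) T

/-! ### The Perles polytope -/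

open Real in
/-- Vertices of the Perles polytope, where `φ` is the golden ratio.  The affine dependences of
these points form the Gale diagram given by the nine-point Perles configuration, in which the pairs
of rows `5, 8`, `6, 9` and `7, 10` are opposite up to positive scaling. -/
def perlesVertex : Fin 12 → Fin 8 → ℝ :=
  let φ : ℝ := goldenRatio
  ![![0, 0, 0, 0, 0, 0, 0, 0],
    ![1, 0, 0, 0, 0, 0, 0, 0],
    ![0, 1, 0, 0, 0, 0, 0, 0],
    ![0, 0, 1, 0, 0, 0, 0, 0],
    ![0, 0, 0, 1, 0, 0, 0, 0],
    ![φ - 2, 2 - φ, 2 - φ, φ - 2, 1, 0, 0, 2 * φ - 3],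
    ![1, -1, 0, 1 - φ, 0, φ, 0, 1],
    ![-φ, -1, -φ - 1, 1, 0, 0, φ + 1, 1],
    ![0, 0, 0, 0, 1, 0, 0, 0],
    ![0, 0, 0, 0, 0, 1, 0, 0],
    ![0, 0, 0, 0, 0, 0, 1, 0],
    ![0, 0, 0, 0, 0, 0, 0, 1]]

/-- The Perles polytope. -/
def perles : Set (Fin 8 → ℝ) := convexHull ℝ (Set.range perlesVertex)

/-- The matrix `S_F(x)`. -/
def perlesSF {R : Type*} [Zero R] (x : Fin 36 → R) : Matrix (Fin 12) (Fin 13) R :=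
  !![0, 0, 0, x 0, x 1, x 2, 0, 0, 0, 0, 0, 0, 0;
     0, 0, 0, x 3, 0, 0, x 4, x 5, x 6, 0, 0, 0, 0;
     0, 0, 0, 0, 0, 0, x 7, 0, 0, x 8, x 9, 0, 0;
     0, 0, 0, 0, x 10, 0, 0, 0, 0, 0, 0, x 11, x 12;
     0, 0, 0, 0, 0, 0, 0, x 13, 0, x 14, 0, x 15, 0;
     x 16, 0, 0, 0, 0, 0, 0, 0, 0, 0, x 17, 0, x 18;
     0, x 19, 0, 0, 0, 0, 0, 0, x 20, 0, 0, 0, 0;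
     0, 0, x 21, 0, 0, x 22, 0, 0, 0, 0, 0, 0, 0;
     x 23, 0, 0, x 24, 0, 0, 0, x 25, 0, 0, 0, 0, 0;
     0, x 26, 0, 0, x 27, 0, 0, 0, 0, x 28, 0, 0, 0;
     0, 0, x 29, 0, 0, 0, x 30, 0, 0, 0, 0, 0, x 31;
     0, 0, 0, 0, 0, x 32, 0, 0, x 33, 0, x 34, x 35, 0]

/-- The variables that are set to `1`. -/
def perlesForest : Finset (Fin 36) :=
  {0, 3, 4, 5, 6, 7, 8, 9, 12, 14, 15, 16, 17, 20, 21, 25, 26, 27, 28, 29, 30, 31, 32, 34}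

/-- The remaining variables. -/
abbrev PerlesVar : Type := {n : Fin 36 // n ∉ perlesForest}

/-- The variables after scaling: those of the forest are `1`, the others stay variables. -/
def scaledVar (k : Type*) [Field k] (n : Fin 36) : MvPolynomial PerlesVar k :=
  if h : n ∈ perlesForest then 1 else MvPolynomial.X ⟨n, h⟩

/-- The scaled reduced slack ideal of the Perles polytope. -/
def perlesIdeal (k : Type*) [Field k] : Ideal (MvPolynomial PerlesVar k) :=
  slackIdeal 8 (perlesSF (scaledVar k))

/-- The listed generators of the scaled reduced slack ideal. -/
def perlesGenerators {R : Type*} [CommRing R] (x : Fin 36 → R) : Set R :=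
  {x 35 ^ 2 + x 35 - 1, x 33 - x 35 - 1, x 24 - x 35, x 23 - x 35, x 22 - 1, x 19 - x 35,
    x 18 - x 35, x 13 - x 35 - 1, x 11 - x 35, x 10 - 1, x 2 - 1, x 1 - x 35 - 1}

end SlackModel

end

/-! ### Faces, vertices, flags and projective images of polytopes. -/

namespace SlackModel
open Set

variable {d : ℕ} {P Q A B : Set (Fin d → ℝ)}

/-! A slack matrix of a realization in dimension 8 factors through homogeneous coordinates of length
nine, so its 10-minors vanish, and for a matrix with the support of `S_F` this is almost rigid. In
`perlesGenerators_eq_zero`, twelve 10-minors, each reduced by the many zeros to a block of size 4 or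
5, express all free entries through `t = x 35` and leave `t² + t = 1`. Only units are cancelled, so
the argument works over every commutative ring. In the localized quotient by the minors it gives one
inclusion of `perlesIdeal_eq`. For the other, modulo the listed generators `S_F` factors through
nine of its rows (`perlesSF_perlesPoint`) and its variables are units.

For a realization, vertices are the atoms of the face lattice, so an isomorphism preserves
incidences and hence the support of `S_F`. Positive scaling along the spanning tree gives `S_F` at
`perlesPoint t` with `t > 0`, which singles out one root: all realizations share one matrix
(`IsSlackMatrix.exists_normalForm`). A triangular invertible 9×9 submatrix, the same one that
produces the flag, can be cancelled from two factorizations of this matrix. What remains is a linear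
map between the homogenized vertices up to positive factors, that is, a projective transformation.
If the vertices are rational, a ℚ-linear functional `ℝ → ℚ` that is nonzero at the 36 positive
slacks produces a rational matrix with the same support that still factors through dimension nine;
then `t` is rational, which is impossible.

The combinatorics of `P` is checked by exact computation in `ℤ[φ]`. The facet list is complete by
`exists_facetSlack_support`: a vertex set containing no facet support lies where some affine
dependence is positive, but nonnegative affine functions are orthogonal to dependences.
Simpliciality of a facet is read off from the Gale vectors of the vertices outside it. -/

theorem IsPolytope.isCompact (hQ : IsPolytope Q) : IsCompact Q := by
  obtain ⟨T, hT, rfl⟩ := hQ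
  exact hT.isCompact_convexHull ℝ

theorem IsPolytope.convex (hQ : IsPolytope Q) : Convex ℝ Q := by
  obtain ⟨T, -, rfl⟩ := hQ
  exact convex_convexHull ℝ T

theorem IsPolytope.finite_extremePoints (hQ : IsPolytope Q) : (Q.extremePoints ℝ).Finite := by
  obtain ⟨T, hT, rfl⟩ := hQ
  exact hT.subset extremePoints_convexHull_subset

/-- Krein–Milman for the face; no closure is needed, because the hull of finitely many extreme
points is compact. -/
theorem IsPolytope.extremePoints_exposed (hQ : IsPolytope Q) (hA : IsExposed ℝ Q A) :
    A = convexHull ℝ (A ∩ Q.extremePoints ℝ) := by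
  have hc := hA.isCompact hQ.isCompact
  have h := closure_convexHull_extremePoints hc (hA.convex hQ.convex)
  rw [hA.isExtreme.extremePoints_eq, IsClosed.closure_eq] at h
  · exact h.symm
  · exact ((hQ.finite_extremePoints.inter_of_right _).isCompact_convexHull ℝ).isClosed

theorem IsPolytope.eq_convexHull (hQ : IsPolytope Q) : Q = convexHull ℝ (Q.extremePoints ℝ) := by
  conv_lhs => rw [hQ.extremePoints_exposed (IsExposed.refl Q)]
  rw [inter_eq_right.2 extremePoints_subset]

theorem IsPolytope.exposed_subset_iff (hQ : IsPolytope Q) (hA : IsExposed ℝ Q A)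
    (hB : IsExposed ℝ Q B) : A ⊆ B ↔ ∀ x ∈ Q.extremePoints ℝ, x ∈ A → x ∈ B := by
  refine ⟨fun h x _ hx => h hx, fun h => ?_⟩
  rw [hQ.extremePoints_exposed hA]
  exact convexHull_min (fun x hx => h x hx.2 hx.1) (hB.convex hQ.convex)

/-- Extreme points of a hull belong to the generating set, so a vertex is outside the hull of the
other vertices. A functional that separates it strictly attains its maximum there only. -/
theorem IsPolytope.isExposed_singleton (hQ : IsPolytope Q) {x : Fin d → ℝ}
    (hx : x ∈ Q.extremePoints ℝ) : IsExposed ℝ Q {x} := by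
  set E := Q.extremePoints ℝ
  have hE : (E \ {x}).Finite := hQ.finite_extremePoints.sdiff
  have hconv : x ∉ convexHull ℝ (E \ {x}) := by
    intro h
    have hx' : x ∈ (convexHull ℝ (E \ {x})).extremePoints ℝ := by
      refine inter_extremePoints_subset_extremePoints_of_subset ?_ ⟨h, hx⟩
      exact (convexHull_mono sdiff_subset).trans_eq hQ.eq_convexHull.symm
    exact (extremePoints_convexHull_subset hx').2 rfl
  obtain ⟨l, u, hlu, hul⟩ := geometric_hahn_banach_closed_point (convex_convexHull ℝ (E \ {x}))
    (hE.isCompact_convexHull ℝ).isClosed hconv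
  have hlt : ∀ y ∈ E, y ≠ x → l y < l x := fun y hy hne =>
    (hlu y (subset_convexHull ℝ _ ⟨hy, hne⟩)).trans hul
  have hle : ∀ y ∈ Q, l y ≤ l x := by
    intro y hy
    rw [hQ.eq_convexHull] at hy
    refine convexHull_min (t := {z | l z ≤ l x}) ?_ ?_ hy
    · intro z hz
      by_cases h : z = x
      · simp [h]
      · exact (hlt z hz h).le
    · exact convex_halfSpace_le l.toLinearMap.isLinear _
  have hexp : IsExposed ℝ Q {z ∈ Q | ∀ y ∈ Q, l y ≤ l z} := fun _ => ⟨l, rfl⟩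
  have : {z ∈ Q | ∀ y ∈ Q, l y ≤ l z} = {x} := by
    rw [hQ.extremePoints_exposed hexp]
    have h2 : {z ∈ Q | ∀ y ∈ Q, l y ≤ l z} ∩ E = {x} := by
      ext z
      constructor
      · rintro ⟨⟨-, hz⟩, hzE⟩
        by_contra hne
        exact absurd (hz x (extremePoints_subset hx)) (not_le.2 (hlt z hzE hne))
      · rintro rfl
        exact ⟨⟨extremePoints_subset hx, hle⟩, hx⟩
    rw [h2, convexHull_singleton]
  rwa [this] at hexp

/-- Exposed faces are exactly the zero sets of valid affine inequalities. -/
theorem isExposed_of_slack {b : ℝ} {α : Fin d → ℝ} (h : ∀ x ∈ Q, 0 ≤ b - α ⬝ᵥ x) :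
    IsExposed ℝ Q {x ∈ Q | b - α ⬝ᵥ x = 0} := by
  rintro ⟨x₀, hx₀, h₀⟩
  refine ⟨LinearMap.toContinuousLinearMap (dotProductBilin ℝ ℝ α), ?_⟩
  ext x
  simp only [mem_ofPred_eq, LinearMap.coe_toContinuousLinearMap']
  change _ ∧ _ ↔ _ ∧ ∀ y ∈ Q, α ⬝ᵥ y ≤ α ⬝ᵥ x
  refine and_congr_right fun hx => ⟨fun hz y hy => by linarith [h y hy], fun hz => ?_⟩
  linarith [h x hx, hz x₀ hx₀]

theorem exists_slack_of_isExposed (hA : IsExposed ℝ Q A) :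
    ∃ (b : ℝ) (α : Fin d → ℝ), (∀ x ∈ Q, 0 ≤ b - α ⬝ᵥ x) ∧ A = {x ∈ Q | b - α ⬝ᵥ x = 0} := by
  rcases A.eq_empty_or_nonempty with rfl | hne
  -- The empty face is the zero set of the constant function one.
  · exact ⟨1, 0, by simp, by simp⟩
  · obtain ⟨l, hl⟩ := hA hne
    obtain ⟨x₀, hx₀⟩ := hne
    have hx₀' := hx₀
    rw [hl] at hx₀'
    have hdot : ∀ x, (fun i => l (Pi.single i 1)) ⬝ᵥ x = l x := by
      intro x
      conv_rhs => rw [pi_eq_sum_univ' x]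
      simp [dotProduct, mul_comm]
    refine ⟨l x₀, fun i => l (Pi.single i 1), fun x hx => ?_, ?_⟩
    · rw [hdot]; linarith [hx₀'.2 x hx]
    · rw [hl]
      ext x
      simp only [mem_ofPred_eq, hdot]
      refine and_congr_right fun hx => ⟨fun hz => ?_, fun hz y hy => ?_⟩
      · linarith [hz x₀ hx₀'.1, hx₀'.2 x hx]
      · linarith [hx₀'.2 y hy]

theorem exists_isSlackMatrix {ι κ : Type*} (v : ι → Fin d → ℝ) (F : κ → Face Q) :
    ∃ S, IsSlackMatrix Q v (fun j => (F j).1) S := by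
  choose b α h1 h2 using fun j => exists_slack_of_isExposed (F j).2
  exact ⟨fun i j => b j - α j ⬝ᵥ v i, b, α, h1, h2, fun _ _ => rfl⟩

/-- The empty face. -/
instance : OrderBot (Face Q) where
  bot := ⟨∅, isExposed_empty⟩
  bot_le _ := empty_subset _

/-- This characterizes vertices by the order alone, so lattice isomorphisms carry vertices to
vertices. -/
theorem IsPolytope.isAtom_iff (hQ : IsPolytope Q) (F : Face Q) :
    IsAtom F ↔ ∃ x ∈ Q.extremePoints ℝ, F.1 = {x} := by
  constructor
  · intro hF
    have hne : (F.1 ∩ Q.extremePoints ℝ).Nonempty := by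
      by_contra hcon
      rw [not_nonempty_iff_eq_empty] at hcon
      refine hF.1 (Subtype.ext ?_)
      rw [hQ.extremePoints_exposed F.2, hcon, convexHull_empty]
      rfl
    obtain ⟨x, hxF, hx⟩ := hne
    refine ⟨x, hx, ?_⟩
    have hle : (⟨{x}, hQ.isExposed_singleton hx⟩ : Face Q) ≤ F := by
      intro y hy
      rw [mem_singleton_iff.1 hy]
      exact hxF
    rcases hF.le_iff.1 hle with h | h
    · exact absurd (congrArg Subtype.val h) (singleton_ne_empty x)
    · rw [← h]
  · rintro ⟨x, hx, hF⟩
    refine ⟨fun h => ?_, fun G hG => ?_⟩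
    · rw [h] at hF
      exact singleton_ne_empty x hF.symm
    · have h1 : G.1 ⊂ {x} := hF ▸ (show G.1 ⊂ F.1 from hG)
      exact Subtype.ext (ssubset_singleton_iff.1 h1)

/-- An isomorphism of face lattices transports the vertices. -/
theorem exists_vertices_of_orderIso (hP : IsPolytope P) (hQ : IsPolytope Q) {ι : Type*}
    {v : ι → Fin d → ℝ} (hv : Function.Injective v) (hvP : range v = P.extremePoints ℝ)
    (e : Face P ≃o Face Q) :
    ∃ w : ι → Fin d → ℝ, Function.Injective w ∧ range w = Q.extremePoints ℝ ∧
      ∀ i (A : Face P), w i ∈ (e A).1 ↔ v i ∈ A.1 := by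
  have hvi : ∀ i, v i ∈ P.extremePoints ℝ := fun i => hvP ▸ mem_range_self i
  let V : ι → Face P := fun i => ⟨{v i}, hP.isExposed_singleton (hvi i)⟩
  have hV : ∀ i, IsAtom (V i) := fun i => (hP.isAtom_iff _).2 ⟨v i, hvi i, rfl⟩
  choose w hw hVw using fun i => (hQ.isAtom_iff _).1 ((e.isAtom_iff (V i)).2 (hV i))
  refine ⟨w, fun i j hij => ?_, ?_, fun i A => ?_⟩
  · have h : e (V i) = e (V j) := Subtype.ext (by rw [hVw, hVw, hij])
    have h2 : ({v i} : Set (Fin d → ℝ)) = {v j} := congrArg Subtype.val (e.injective h)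
    exact hv (singleton_injective h2)
  · refine subset_antisymm (range_subset_iff.2 hw) fun x hx => ?_
    have hat : IsAtom (⟨{x}, hQ.isExposed_singleton hx⟩ : Face Q) :=
      (hQ.isAtom_iff _).2 ⟨x, hx, rfl⟩
    rw [← e.symm.isAtom_iff] at hat
    obtain ⟨y, hy, hyx⟩ := (hP.isAtom_iff _).1 hat
    rw [← hvP] at hy
    obtain ⟨i, rfl⟩ := hy
    refine ⟨i, ?_⟩
    have h : e (V i) = ⟨{x}, hQ.isExposed_singleton hx⟩ := by
      rw [← e.eq_symm_apply]
      exact Subtype.ext hyx.symm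
    have h2 := congrArg Subtype.val h
    rw [hVw i] at h2
    exact singleton_injective h2
  · have h : V i ≤ A ↔ e (V i) ≤ e A := e.le_iff_le.symm
    have h1 : V i ≤ A ↔ v i ∈ A.1 := singleton_subset_iff
    have h2 : e (V i) ≤ e A ↔ w i ∈ (e A).1 := by
      rw [← singleton_subset_iff, ← hVw i]; rfl
    rw [← h1, ← h2, h]

/-- The dimension of the linear span of the homogenization. -/
noncomputable def homogRank (A : Set (Fin d → ℝ)) : ℕ :=
  Module.finrank ℝ (Submodule.span ℝ (homog '' A))

theorem homogRank_le (A : Set (Fin d → ℝ)) : homogRank A ≤ d + 1 := by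
  refine (Submodule.finrank_le _).trans ?_
  simp

/-- A slack function of the smaller face is a linear functional on homogeneous coordinates. It
vanishes on the span of that face, hence equal spans would force the larger face into its zero set.
-/
theorem homogRank_strictMono : StrictMono fun F : Face Q => homogRank F.1 := by
  intro F G hFG
  have hss : F.1 ⊂ G.1 := hFG
  have hle : Submodule.span ℝ (homog '' F.1) ≤ Submodule.span ℝ (homog '' G.1) :=
    Submodule.span_mono (image_mono hss.1)
  refine Submodule.finrank_lt_finrank_of_lt (lt_of_le_of_ne hle fun heq => hss.2 ?_)
  obtain ⟨b, α, h1, h2⟩ := exists_slack_of_isExposed F.2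
  let l : (Fin d ⊕ Unit → ℝ) →ₗ[ℝ] ℝ := dotProductBilin ℝ ℝ (Sum.elim (-α) fun _ => b)
  have hl : ∀ x, l (homog x) = b - α ⬝ᵥ x := by
    intro x
    change (Sum.elim (-α) fun _ => b) ⬝ᵥ homog x = _
    simp [homog, dotProduct]
    ring
  have hker : Submodule.span ℝ (homog '' F.1) ≤ LinearMap.ker l := by
    rw [Submodule.span_le]
    rintro _ ⟨x, hx, rfl⟩
    rw [h2] at hx
    exact (hl x).trans hx.2
  intro x hx
  have hxk : l (homog x) = 0 := hker (heq ▸ Submodule.subset_span ⟨x, hx, rfl⟩)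
  rw [h2]
  exact ⟨G.2.subset hx, (hl x).symm.trans hxk⟩

/-- A strictly monotone sequence of `d + 2` faces is a maximal chain. -/
theorem exists_flag_of_strictMono (f : Fin (d + 2) → Face Q) (hf : StrictMono f) :
    ∃ c : Flag (Face Q), ∀ F ∈ c, F ∈ range f := by
  let ρ : Fin (d + 2) → Fin (d + 2) := fun i => ⟨homogRank (f i).1, by
    have := homogRank_le (f i).1; omega⟩
  have hρ : StrictMono ρ := fun i j hij => homogRank_strictMono (hf hij)
  -- There are only `d + 2` possible ranks, from 0 for the empty face to `d + 1`. The sequence uses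
  -- all of them, so a further comparable face shares its rank with a member and equals it.
  have hρs : Function.Surjective ρ := Finite.surjective_of_injective hρ.injective
  have hchain : IsChain (· ≤ ·) (range f) := by
    rintro _ ⟨i, rfl⟩ _ ⟨j, rfl⟩ -
    exact (le_total i j).imp (fun h => hf.monotone h) (fun h => hf.monotone h)
  refine ⟨⟨range f, hchain, fun s hs hsub => subset_antisymm hsub fun G hG => ?_⟩, fun F hF => hF⟩
  obtain ⟨i, hi⟩ := hρs ⟨homogRank G.1, by have := homogRank_le G.1; omega⟩
  have hrank : homogRank (f i).1 = homogRank G.1 := congrArg Fin.val hi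
  refine ⟨i, ?_⟩
  rcases hs.total (hsub ⟨i, rfl⟩) hG with h | h
  · exact h.eq_of_not_lt fun hlt => (homogRank_strictMono hlt).ne hrank
  · exact (h.eq_of_not_lt fun hlt => (homogRank_strictMono hlt).ne' hrank).symm

theorem mem_convexHull_range_iff {E ι : Type*} [AddCommGroup E] [Module ℝ E] [Fintype ι]
    (u : ι → E) (x : E) : x ∈ convexHull ℝ (range u) ↔
      ∃ c : ι → ℝ, (∀ i, 0 ≤ c i) ∧ ∑ i, c i = 1 ∧ ∑ i, c i • u i = x := by
  classical
  constructor
  · intro hx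
    refine convexHull_min (t := {x | ∃ c : ι → ℝ, (∀ i, 0 ≤ c i) ∧ ∑ i, c i = 1 ∧
      ∑ i, c i • u i = x}) ?_ ?_ hx
    · rintro _ ⟨i, rfl⟩
      refine ⟨Pi.single i 1, fun j => ?_, by simp, by simp [Pi.single_apply, ite_smul]⟩
      by_cases h : j = i <;> simp [h]
    · rintro _ ⟨c, hc, hc1, rfl⟩ _ ⟨c', hc', hc1', rfl⟩ p q hp hq hpq
      refine ⟨fun i => p * c i + q * c' i,
        fun i => add_nonneg (mul_nonneg hp (hc i)) (mul_nonneg hq (hc' i)), ?_, ?_⟩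
      · rw [Finset.sum_add_distrib, ← Finset.mul_sum, ← Finset.mul_sum, hc1, hc1']
        simpa using hpq
      · simp only [add_smul, mul_smul, Finset.sum_add_distrib, Finset.smul_sum]
  · rintro ⟨c, hc, hc1, rfl⟩
    exact mem_convexHull_of_exists_fintype c u hc hc1 (fun i => mem_range_self i) rfl

/-- A matrix that maps homogenized points to positive multiples of homogenized points induces
a projective transformation between the convex hulls. -/
theorem projEquiv_of_mulVec {ι : Type*} [Finite ι] {v w : ι → Fin d → ℝ}
    (M : Matrix (Fin d ⊕ Unit) (Fin d ⊕ Unit) ℝ) (hM : IsUnit M.det) {μ : ι → ℝ}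
    (hμ : ∀ i, 0 < μ i) (h : ∀ i, M.mulVec (homog (v i)) = μ i • homog (w i)) :
    ProjEquiv (convexHull ℝ (range v)) (convexHull ℝ (range w)) := by
  cases nonempty_fintype ι
  have hsum : ∀ c : ι → ℝ, ∑ i, c i = 1 → M.mulVec (homog (∑ i, c i • v i)) =
      ∑ i, (c i * μ i) • homog (w i) := by
    intro c hc
    have h1 : homog (∑ i, c i • v i) = ∑ i, c i • homog (v i) := by
      funext k
      rcases k with k | k <;> simp [homog, Finset.sum_apply, hc]
    rw [h1, Matrix.mulVec_sum]
    refine Finset.sum_congr rfl fun i _ => ?_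
    rw [Matrix.mulVec_smul, h, smul_smul]
  have hinr : ∀ c : ι → ℝ, (∑ i, (c i * μ i) • homog (w i)) (Sum.inr ()) = ∑ i, c i * μ i := by
    intro c; simp [homog, Finset.sum_apply]
  have hinl : ∀ (c : ι → ℝ) k, (∑ i, (c i * μ i) • homog (w i)) (Sum.inl k) =
      ∑ i, c i * μ i * w i k := by
    intro c k; simp [homog, Finset.sum_apply]
  have hpos : ∀ c : ι → ℝ, (∀ i, 0 ≤ c i) → ∑ i, c i = 1 → 0 < ∑ i, c i * μ i := by
    intro c hc hc1
    obtain ⟨i, -, hi⟩ := Finset.exists_ne_zero_of_sum_ne_zero (hc1.trans_ne one_ne_zero)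
    exact Finset.sum_pos' (fun i _ => mul_nonneg (hc i) (hμ i).le)
      ⟨i, Finset.mem_univ i, mul_pos (lt_of_le_of_ne (hc i) hi.symm) (hμ i)⟩
  refine ⟨M, hM, ?_, ?_⟩
  · intro x hx
    obtain ⟨c, hc, hc1, rfl⟩ := (mem_convexHull_range_iff v x).1 hx
    rw [hsum c hc1, hinr]
    exact hpos c hc hc1
  · ext y
    rw [mem_convexHull_range_iff w y]
    constructor
    · rintro ⟨c, hc, hc1, rfl⟩
      -- The transformation multiplies the weights by `μ` and renormalizes; a preimage therefore has
      -- weights proportional to `c i / μ i`.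
      have hs : 0 < ∑ i, c i * (μ i)⁻¹ := by
        obtain ⟨i, -, hi⟩ := Finset.exists_ne_zero_of_sum_ne_zero (hc1.trans_ne one_ne_zero)
        exact Finset.sum_pos' (fun i _ => mul_nonneg (hc i) (inv_pos.2 (hμ i)).le)
          ⟨i, Finset.mem_univ i,
            mul_pos (lt_of_le_of_ne (hc i) hi.symm) (inv_pos.2 (hμ i))⟩
      set s := ∑ i, c i * (μ i)⁻¹
      have hb1 : ∑ i, c i * (μ i)⁻¹ / s = 1 := by
        rw [← Finset.sum_div, div_self hs.ne']
      have hbμ : ∀ i, c i * (μ i)⁻¹ / s * μ i = c i / s := fun i => by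
        have := (hμ i).ne'
        field_simp
      refine ⟨∑ i, (c i * (μ i)⁻¹ / s) • v i, (mem_convexHull_range_iff v _).2
        ⟨_, fun i => div_nonneg (mul_nonneg (hc i) (inv_pos.2 (hμ i)).le) hs.le, hb1, rfl⟩, ?_⟩
      funext k
      beta_reduce
      rw [hsum _ hb1, hinr, hinl]
      simp only [hbμ]
      rw [← Finset.sum_div, hc1]
      simp only [Finset.sum_apply, Pi.smul_apply, smul_eq_mul]
      rw [Finset.sum_div]
      refine Finset.sum_congr rfl fun i _ => ?_
      field_simp
    · rintro ⟨x, hx, rfl⟩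
      obtain ⟨c, hc, hc1, rfl⟩ := (mem_convexHull_range_iff v x).1 hx
      have hp := hpos c hc hc1
      refine ⟨fun i => c i * μ i / ∑ i, c i * μ i,
        fun i => div_nonneg (mul_nonneg (hc i) (hμ i).le) hp.le, ?_, ?_⟩
      · rw [← Finset.sum_div, div_self hp.ne']
      · funext k
        simp only [hsum c hc1, hinr, hinl, Finset.sum_apply, Pi.smul_apply, smul_eq_mul]
        rw [Finset.sum_div]
        refine Finset.sum_congr rfl fun i _ => ?_
        ring

end SlackModel

/-! ### Minors of `S_F` and the scaled reduced slack ideal. -/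

namespace SlackModel

/-- The position of each variable in `S_F`, as a symbolic matrix with zero. -/
abbrev perlesIndex : Matrix (Fin 12) (Fin 13) (WithZero (Fin 36)) :=
  perlesSF (fun n => (n : WithZero (Fin 36)))

/-- Entries are zeros or variables, with no arithmetic, so no additive structure is needed. This
makes `perlesIndex` a universal pattern on which incidences can be decided. -/
theorem perlesSF_map {R R' : Type*} [Zero R] [Zero R'] (f : R → R') (hf : f 0 = 0)
    (x : Fin 36 → R) (i : Fin 12) (j : Fin 13) :
    perlesSF (fun n => f (x n)) i j = f (perlesSF x i j) := by
  fin_cases i <;> fin_cases j <;> first | rfl | exact hf.symm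

theorem perlesSF_eq {R : Type*} [Zero R] (x : Fin 36 → R) (i : Fin 12) (j : Fin 13) :
    perlesSF x i j = Option.elim (perlesIndex i j) 0 x :=
  perlesSF_map (fun o : WithZero (Fin 36) => Option.elim o 0 x) rfl (fun n => (n : WithZero (Fin 36))) i j

theorem perlesSF_eq_zero {R : Type*} [Zero R] (x : Fin 36 → R) {i : Fin 12} {j : Fin 13}
    (h : perlesIndex i j = 0) : perlesSF x i j = 0 := by
  rw [perlesSF_eq, h]; rfl

theorem perlesSF_of_index {R : Type*} [Zero R] (x : Fin 36 → R) {i : Fin 12} {j : Fin 13}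
    {n : Fin 36} (h : perlesIndex i j = n) : perlesSF x i j = x n := by
  rw [perlesSF_eq, h]; rfl

open Matrix in
theorem det_submatrix_cons_of_row {R ι κ : Type*} [CommRing R] (S : Matrix ι κ R) {n : ℕ}
    {a : ι} {b : κ} {r : Fin n → ι} {c : Fin n → κ} (h : ∀ j, S a (c j) = 0) :
    (S.submatrix (vecCons a r) (vecCons b c)).det = S a b * (S.submatrix r c).det := by
  rw [det_succ_row_zero, Fin.sum_univ_succ, Finset.sum_eq_zero]
  · simp only [Fin.val_zero, pow_zero, one_mul, add_zero, Fin.succAbove_zero,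
      submatrix_submatrix]
    rfl
  · intro j _
    simp [h]

open Matrix in
theorem det_submatrix_cons_of_col {R ι κ : Type*} [CommRing R] (S : Matrix ι κ R) {n : ℕ}
    {a : ι} {b : κ} {r : Fin n → ι} {c : Fin n → κ} (h : ∀ i, S (r i) b = 0) :
    (S.submatrix (vecCons a r) (vecCons b c)).det = S a b * (S.submatrix r c).det := by
  have := det_submatrix_cons_of_row Sᵀ (a := b) (b := a) (r := c) (c := r) h
  rw [← det_transpose, transpose_submatrix, this, ← det_transpose (S.submatrix r c)]
  rfl

/-- Laplace expansion along a row or column with a single possibly nonzero entry; that entry is a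
unit and can be cancelled. -/
theorem perlesSF_minor_peel {R : Type*} [CommRing R] (x : Fin 36 → R) {n : ℕ}
    {a : Fin 12} {b : Fin 13} {r : Fin n → Fin 12} {c : Fin n → Fin 13} (m : Fin 36)
    (hab : perlesIndex a b = m)
    (h : (∀ j, perlesIndex a (c j) = 0) ∨ (∀ i, perlesIndex (r i) b = 0))
    (hm : IsUnit (x m))
    (h0 : ((perlesSF x).submatrix (Matrix.vecCons a r) (Matrix.vecCons b c)).det = 0) :
    ((perlesSF x).submatrix r c).det = 0 := by
  rcases h with h | h
  · rw [det_submatrix_cons_of_row _ (fun j => perlesSF_eq_zero x (h j)),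
      perlesSF_of_index x hab] at h0
    exact hm.mul_right_eq_zero.1 h0
  · rw [det_submatrix_cons_of_col _ (fun j => perlesSF_eq_zero x (h j)),
      perlesSF_of_index x hab] at h0
    exact hm.mul_right_eq_zero.1 h0


theorem det_fin_four {R : Type*} [CommRing R] (A : Matrix (Fin 4) (Fin 4) R) :
    A.det = A 0 0 * (A 1 1 * (A 2 2 * A 3 3 - A 2 3 * A 3 2)
        - A 1 2 * (A 2 1 * A 3 3 - A 2 3 * A 3 1) + A 1 3 * (A 2 1 * A 3 2 - A 2 2 * A 3 1))
      - A 0 1 * (A 1 0 * (A 2 2 * A 3 3 - A 2 3 * A 3 2)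
        - A 1 2 * (A 2 0 * A 3 3 - A 2 3 * A 3 0) + A 1 3 * (A 2 0 * A 3 2 - A 2 2 * A 3 0))
      + A 0 2 * (A 1 0 * (A 2 1 * A 3 3 - A 2 3 * A 3 1)
        - A 1 1 * (A 2 0 * A 3 3 - A 2 3 * A 3 0) + A 1 3 * (A 2 0 * A 3 1 - A 2 1 * A 3 0))
      - A 0 3 * (A 1 0 * (A 2 1 * A 3 2 - A 2 2 * A 3 1)
        - A 1 1 * (A 2 0 * A 3 2 - A 2 2 * A 3 0) + A 1 2 * (A 2 0 * A 3 1 - A 2 1 * A 3 0)) := by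
  rw [Matrix.det_succ_row_zero]
  simp only [Fin.sum_univ_four, Matrix.det_fin_three, Matrix.submatrix_apply,
    show (Fin.succ 0 : Fin 4) = 1 from rfl, show (Fin.succ 1 : Fin 4) = 2 from rfl,
    show (Fin.succ 2 : Fin 4) = 3 from rfl,
    show (Fin.succAbove (0 : Fin 4) 0) = 1 from rfl, show (Fin.succAbove (0 : Fin 4) 1) = 2 from rfl,
    show (Fin.succAbove (0 : Fin 4) 2) = 3 from rfl,
    show (Fin.succAbove (1 : Fin 4) 0) = 0 from rfl, show (Fin.succAbove (1 : Fin 4) 1) = 2 from rfl,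
    show (Fin.succAbove (1 : Fin 4) 2) = 3 from rfl,
    show (Fin.succAbove (2 : Fin 4) 0) = 0 from rfl, show (Fin.succAbove (2 : Fin 4) 1) = 1 from rfl,
    show (Fin.succAbove (2 : Fin 4) 2) = 3 from rfl,
    show (Fin.succAbove (3 : Fin 4) 0) = 0 from rfl, show (Fin.succAbove (3 : Fin 4) 1) = 1 from rfl,
    show (Fin.succAbove (3 : Fin 4) 2) = 2 from rfl, Fin.val_zero, Fin.val_one, Fin.val_two,
    show ((3 : Fin 4) : ℕ) = 3 from rfl]
  ring

/-- The rows and columns of each minor are listed in the order in which pivots are peeled off, with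
the remaining small block last. All pivots are forest entries except `x 1` in `h10`, where
invertibility is used without normalization. -/
theorem perlesGenerators_eq_zero {R : Type*} [CommRing R] (x : Fin 36 → R)
    (hx : ∀ n ∈ perlesForest, x n = 1) (hu : ∀ n, IsUnit (x n))
    (hS : ∀ (r : Fin 10 → Fin 12) (c : Fin 10 → Fin 13), ((perlesSF x).submatrix r c).det = 0)
    (p : R) (hp : p ∈ perlesGenerators x) : p = 0 := by
  have e0 := hx 0 (by decide)
  have e3 := hx 3 (by decide)
  have e4 := hx 4 (by decide)
  have e5 := hx 5 (by decide)
  have e6 := hx 6 (by decide)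
  have e7 := hx 7 (by decide)
  have e8 := hx 8 (by decide)
  have e9 := hx 9 (by decide)
  have e12 := hx 12 (by decide)
  have e14 := hx 14 (by decide)
  have e15 := hx 15 (by decide)
  have e16 := hx 16 (by decide)
  have e17 := hx 17 (by decide)
  have e20 := hx 20 (by decide)
  have e21 := hx 21 (by decide)
  have e25 := hx 25 (by decide)
  have e26 := hx 26 (by decide)
  have e27 := hx 27 (by decide)
  have e28 := hx 28 (by decide)
  have e29 := hx 29 (by decide)
  have e30 := hx 30 (by decide)
  have e31 := hx 31 (by decide)
  have e32 := hx 32 (by decide)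
  have e34 := hx 34 (by decide)
  have h0 : x 2 = 1 := by
    have h := hS ![3, 4, 9, 6, 5, 7, 0, 1, 2, 11] ![12, 9, 1, 8, 0, 2, 3, 5, 6, 10]
    replace h := perlesSF_minor_peel x 12 (by decide) (by decide) (hu _) h
    replace h := perlesSF_minor_peel x 14 (by decide) (by decide) (hu _) h
    replace h := perlesSF_minor_peel x 26 (by decide) (by decide) (hu _) h
    replace h := perlesSF_minor_peel x 20 (by decide) (by decide) (hu _) h
    replace h := perlesSF_minor_peel x 16 (by decide) (by decide) (hu _) h
    replace h := perlesSF_minor_peel x 21 (by decide) (by decide) (hu _) h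
    rw [det_fin_four] at h
    simp [perlesSF, e0, e3, e4, e5, e6, e7, e8, e9, e32, e34] at h
    linear_combination -h
  have h1 : x 22 = 1 := by
    have h := hS ![3, 9, 6, 5, 1, 0, 2, 7, 10, 11] ![12, 1, 8, 0, 7, 3, 2, 5, 6, 10]
    replace h := perlesSF_minor_peel x 12 (by decide) (by decide) (hu _) h
    replace h := perlesSF_minor_peel x 26 (by decide) (by decide) (hu _) h
    replace h := perlesSF_minor_peel x 20 (by decide) (by decide) (hu _) h
    replace h := perlesSF_minor_peel x 16 (by decide) (by decide) (hu _) h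
    replace h := perlesSF_minor_peel x 5 (by decide) (by decide) (hu _) h
    replace h := perlesSF_minor_peel x 0 (by decide) (by decide) (hu _) h
    rw [det_fin_four] at h
    simp [perlesSF, e7, e8, e9, e21, e29, e30, e31, e32, e34] at h
    linear_combination -h
  have h2 : x 10 = 1 := by
    have h := hS ![6, 11, 7, 5, 1, 0, 2, 3, 9, 10] ![8, 5, 2, 0, 7, 3, 4, 6, 9, 12]
    replace h := perlesSF_minor_peel x 20 (by decide) (by decide) (hu _) h
    replace h := perlesSF_minor_peel x 32 (by decide) (by decide) (hu _) h
    replace h := perlesSF_minor_peel x 21 (by decide) (by decide) (hu _) h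
    replace h := perlesSF_minor_peel x 16 (by decide) (by decide) (hu _) h
    replace h := perlesSF_minor_peel x 5 (by decide) (by decide) (hu _) h
    replace h := perlesSF_minor_peel x 0 (by decide) (by decide) (hu _) h
    rw [det_fin_four] at h
    simp [perlesSF, e7, e8, e9, e12, e26, e27, e28, e29, e30, e31] at h
    linear_combination -h
  have h3 : x 24 = x 23 := by
    have h := hS ![3, 4, 9, 6, 7, 11, 1, 2, 5, 8] ![12, 9, 1, 8, 2, 5, 0, 3, 6, 10]
    replace h := perlesSF_minor_peel x 12 (by decide) (by decide) (hu _) h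
    replace h := perlesSF_minor_peel x 14 (by decide) (by decide) (hu _) h
    replace h := perlesSF_minor_peel x 26 (by decide) (by decide) (hu _) h
    replace h := perlesSF_minor_peel x 20 (by decide) (by decide) (hu _) h
    replace h := perlesSF_minor_peel x 21 (by decide) (by decide) (hu _) h
    replace h := perlesSF_minor_peel x 32 (by decide) (by decide) (hu _) h
    rw [det_fin_four] at h
    simp [perlesSF, e3, e4, e5, e6, e7, e8, e9, e16, e17, e25] at h
    linear_combination h
  have h4 : x 13 * x 23 = 1 := by
    have h := hS ![0, 3, 7, 10, 9, 1, 2, 4, 5, 8] ![3, 12, 2, 6, 1, 8, 0, 7, 9, 10]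
    replace h := perlesSF_minor_peel x 0 (by decide) (by decide) (hu _) h
    replace h := perlesSF_minor_peel x 12 (by decide) (by decide) (hu _) h
    replace h := perlesSF_minor_peel x 21 (by decide) (by decide) (hu _) h
    replace h := perlesSF_minor_peel x 30 (by decide) (by decide) (hu _) h
    replace h := perlesSF_minor_peel x 26 (by decide) (by decide) (hu _) h
    replace h := perlesSF_minor_peel x 6 (by decide) (by decide) (hu _) h
    rw [det_fin_four] at h
    simp [perlesSF, e7, e8, e9, e14, e15, e16, e17, e25] at h
    linear_combination h
  have h5 : x 13 * x 19 = 1 := by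
    have h := hS ![0, 3, 7, 10, 5, 2, 1, 4, 6, 9] ![3, 12, 2, 6, 0, 10, 1, 7, 8, 9]
    replace h := perlesSF_minor_peel x 0 (by decide) (by decide) (hu _) h
    replace h := perlesSF_minor_peel x 12 (by decide) (by decide) (hu _) h
    replace h := perlesSF_minor_peel x 21 (by decide) (by decide) (hu _) h
    replace h := perlesSF_minor_peel x 30 (by decide) (by decide) (hu _) h
    replace h := perlesSF_minor_peel x 16 (by decide) (by decide) (hu _) h
    replace h := perlesSF_minor_peel x 9 (by decide) (by decide) (hu _) h
    rw [det_fin_four] at h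
    simp [perlesSF, e3, e4, e5, e6, e14, e15, e20, e26, e27, e28] at h
    linear_combination -h
  have h6 : x 11 * x 13 = 1 := by
    have h := hS ![0, 7, 9, 6, 5, 2, 1, 3, 4, 10] ![3, 2, 1, 8, 0, 10, 6, 7, 11, 12]
    replace h := perlesSF_minor_peel x 0 (by decide) (by decide) (hu _) h
    replace h := perlesSF_minor_peel x 21 (by decide) (by decide) (hu _) h
    replace h := perlesSF_minor_peel x 26 (by decide) (by decide) (hu _) h
    replace h := perlesSF_minor_peel x 20 (by decide) (by decide) (hu _) h
    replace h := perlesSF_minor_peel x 16 (by decide) (by decide) (hu _) h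
    replace h := perlesSF_minor_peel x 9 (by decide) (by decide) (hu _) h
    rw [det_fin_four] at h
    simp [perlesSF, e3, e4, e5, e6, e12, e14, e15, e29, e30, e31] at h
    linear_combination -h
  have h7 : x 13 * x 35 = 1 := by
    have h := hS ![0, 7, 9, 6, 5, 3, 1, 2, 4, 11] ![3, 2, 1, 8, 0, 12, 6, 7, 10, 11]
    replace h := perlesSF_minor_peel x 0 (by decide) (by decide) (hu _) h
    replace h := perlesSF_minor_peel x 21 (by decide) (by decide) (hu _) h
    replace h := perlesSF_minor_peel x 26 (by decide) (by decide) (hu _) h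
    replace h := perlesSF_minor_peel x 20 (by decide) (by decide) (hu _) h
    replace h := perlesSF_minor_peel x 16 (by decide) (by decide) (hu _) h
    replace h := perlesSF_minor_peel x 12 (by decide) (by decide) (hu _) h
    rw [det_fin_four] at h
    simp [perlesSF, e3, e4, e5, e6, e7, e8, e9, e14, e15, e32, e34] at h
    linear_combination -h
  have h8 : x 33 = x 13 := by
    have h := hS ![0, 3, 7, 10, 5, 9, 1, 2, 4, 11] ![3, 12, 2, 6, 0, 1, 7, 8, 9, 10]
    replace h := perlesSF_minor_peel x 0 (by decide) (by decide) (hu _) h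
    replace h := perlesSF_minor_peel x 12 (by decide) (by decide) (hu _) h
    replace h := perlesSF_minor_peel x 21 (by decide) (by decide) (hu _) h
    replace h := perlesSF_minor_peel x 30 (by decide) (by decide) (hu _) h
    replace h := perlesSF_minor_peel x 16 (by decide) (by decide) (hu _) h
    replace h := perlesSF_minor_peel x 26 (by decide) (by decide) (hu _) h
    rw [det_fin_four] at h
    simp [perlesSF, e3, e4, e5, e6, e7, e8, e9, e14, e15, e32, e34] at h
    linear_combination -h
  have h9 : x 1 * x 11 * x 13 * x 24 = x 10 := by
    have h := hS ![5, 7, 10, 2, 9, 1, 0, 3, 4, 8] ![0, 2, 6, 9, 1, 8, 3, 4, 7, 11]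
    replace h := perlesSF_minor_peel x 16 (by decide) (by decide) (hu _) h
    replace h := perlesSF_minor_peel x 21 (by decide) (by decide) (hu _) h
    replace h := perlesSF_minor_peel x 30 (by decide) (by decide) (hu _) h
    replace h := perlesSF_minor_peel x 8 (by decide) (by decide) (hu _) h
    replace h := perlesSF_minor_peel x 26 (by decide) (by decide) (hu _) h
    replace h := perlesSF_minor_peel x 6 (by decide) (by decide) (hu _) h
    rw [det_fin_four] at h
    simp [perlesSF, e0, e12, e14, e15, e25] at h
    linear_combination h
  have h10 : x 13 * x 24 * x 35 + x 24 * x 33 = x 33 := by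
    have h := hS ![5, 7, 10, 2, 9, 0, 1, 4, 8, 11] ![0, 2, 6, 9, 1, 4, 3, 7, 8, 11]
    replace h := perlesSF_minor_peel x 16 (by decide) (by decide) (hu _) h
    replace h := perlesSF_minor_peel x 21 (by decide) (by decide) (hu _) h
    replace h := perlesSF_minor_peel x 30 (by decide) (by decide) (hu _) h
    replace h := perlesSF_minor_peel x 8 (by decide) (by decide) (hu _) h
    replace h := perlesSF_minor_peel x 26 (by decide) (by decide) (hu _) h
    replace h := perlesSF_minor_peel x 1 (by decide) (by decide) (hu _) h
    rw [det_fin_four] at h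
    simp [perlesSF, e3, e4, e5, e6, e14, e15, e25, e32, e34] at h
    linear_combination -h
  have h11 : x 18 * x 23 + x 23 = 1 := by
    have h := hS ![0, 7, 9, 6, 4, 1, 2, 5, 8, 10] ![3, 2, 1, 8, 11, 0, 6, 7, 10, 12]
    replace h := perlesSF_minor_peel x 0 (by decide) (by decide) (hu _) h
    replace h := perlesSF_minor_peel x 21 (by decide) (by decide) (hu _) h
    replace h := perlesSF_minor_peel x 26 (by decide) (by decide) (hu _) h
    replace h := perlesSF_minor_peel x 20 (by decide) (by decide) (hu _) h
    replace h := perlesSF_minor_peel x 15 (by decide) (by decide) (hu _) h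
    -- Every row and column of this block carries at least two variables, so peeling stops at size
    -- five.
    rw [show (perlesSF x).submatrix ![1, 2, 5, 8, 10] ![0, 6, 7, 10, 12] =
      !![0, x 4, x 5, 0, 0; 0, x 7, 0, x 9, 0; x 16, 0, 0, x 17, x 18; x 23, 0, x 25, 0, 0;
        0, x 30, 0, 0, x 31] by ext i j; fin_cases i <;> fin_cases j <;> rfl,
      e4, e5, e7, e9, e16, e17, e25, e30, e31, Matrix.det_succ_row_zero] at h
    simp only [Fin.sum_univ_five, det_fin_four, Matrix.submatrix_apply,
      show (Fin.succ 0 : Fin 5) = 1 from rfl, show (Fin.succ 1 : Fin 5) = 2 from rfl,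
      show (Fin.succ 2 : Fin 5) = 3 from rfl, show (Fin.succ 3 : Fin 5) = 4 from rfl,
      show (Fin.succAbove (1 : Fin 5) 0) = 0 from rfl,
      show (Fin.succAbove (1 : Fin 5) 1) = 2 from rfl,
      show (Fin.succAbove (1 : Fin 5) 2) = 3 from rfl,
      show (Fin.succAbove (1 : Fin 5) 3) = 4 from rfl,
      show (Fin.succAbove (2 : Fin 5) 0) = 0 from rfl,
      show (Fin.succAbove (2 : Fin 5) 1) = 1 from rfl,
      show (Fin.succAbove (2 : Fin 5) 2) = 3 from rfl,
      show (Fin.succAbove (2 : Fin 5) 3) = 4 from rfl] at h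
    simp at h
    linear_combination h
  -- The entries 23, 19, 11 and 35 are all inverse to `x 13`, hence equal.
  have c23 : x 23 = x 35 := (hu 13).mul_left_cancel (h4.trans h7.symm)
  have c19 : x 19 = x 35 := (hu 13).mul_left_cancel (h5.trans h7.symm)
  have c11 : x 11 = x 35 := (hu 13).mul_left_cancel (by rw [mul_comm, h6, h7])
  -- With `t = x 35`, relation `h10` becomes `x 13 * t² + t * x 13 = x 13`, and `x 13 * t = 1` turns
  -- its left side into `t + 1`.
  have c13 : x 13 = x 35 + 1 := by
    rw [h3, c23, h8] at h10
    linear_combination -h10 + (x 35 + 1) * h7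
  have ht : x 35 ^ 2 + x 35 = 1 := by rw [c13] at h7; linear_combination h7
  have c1 : x 1 = x 35 + 1 := by
    refine (hu 35).mul_left_cancel ?_
    rw [h3, c23, h2, mul_assoc (x 1), h6] at h9
    linear_combination h9 - ht
  have c18 : x 18 = x 35 := by
    refine (hu 35).mul_left_cancel ?_
    rw [c23] at h11
    linear_combination h11 - ht
  simp only [perlesGenerators, Set.mem_insert_iff, Set.mem_singleton_iff] at hp
  rcases hp with rfl | rfl | rfl | rfl | rfl | rfl | rfl | rfl | rfl | rfl | rfl | rfl
  · linear_combination ht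
  · linear_combination h8 + c13
  · linear_combination h3 + c23
  · linear_combination c23
  · linear_combination h1
  · linear_combination c19
  · linear_combination c18
  · linear_combination c13
  · linear_combination c11
  · linear_combination h2
  · linear_combination h0
  · linear_combination c1

/-- The common zeros of the listed generators, parametrized by the entry `35`. -/
def perlesPoint {R : Type*} [CommRing R] (t : R) : Fin 36 → R :=
  ![1, t + 1, 1, 1, 1, 1, 1, 1, 1, 1, 1, t, 1, t + 1, 1, 1, 1, 1, t, t, 1, 1, 1, t, t, 1, 1, 1, 1,
    1, 1, 1, 1, t + 1, 1, t]

theorem eq_perlesPoint {R : Type*} [CommRing R] {x : Fin 36 → R}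
    (hx : ∀ n ∈ perlesForest, x n = 1) (hg : ∀ p ∈ perlesGenerators x, p = 0) :
    x = perlesPoint (x 35) ∧ x 35 ^ 2 + x 35 = 1 := by
  simp only [perlesGenerators, Set.mem_insert_iff, Set.mem_singleton_iff, forall_eq_or_imp,
    forall_eq] at hg
  obtain ⟨g35, g33, g24, g23, g22, g19, g18, g13, g11, g10, g2, g1⟩ := hg
  refine ⟨?_, by linear_combination g35⟩
  simp only [perlesForest, Finset.mem_insert, Finset.mem_singleton, forall_eq_or_imp,
    forall_eq] at hx
  funext n
  fin_cases n <;> first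
    | rfl
    | (simp [perlesPoint, hx]; done)
    | (simp only [perlesPoint]; simp; first
        | linear_combination g33 | linear_combination g24 | linear_combination g23
        | linear_combination g22 | linear_combination g19 | linear_combination g18
        | linear_combination g13 | linear_combination g11 | linear_combination g10
        | linear_combination g2 | linear_combination g1)

/-- Coefficients that express the rows of `S_F` at `perlesPoint t` through nine of them. -/
def perlesRowCoeff {R : Type*} [CommRing R] (t : R) : Matrix (Fin 12) (Fin 9) R :=
  !![1, 0, 0, 0, 0, 0, 0, 0, 0;
     0, 1, 0, 0, 0, 0, 0, 0, 0;
     0, 0, 1, 0, 0, 0, 0, 0, 0;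
     0, 0, 0, 1, 0, 0, 0, 0, 0;
     0, 0, 0, 0, 1, 0, 0, 0, 0;
     t - 1, -t, t, t, -t, 1 + t, 0, 0, 1 - t;
     t - 1, 1 - t, t - 1, 0, 1 - 2 * t, 0, t, 0, 1 - t;
     t, -t, t - 1, -1, 1 - t, 0, 0, 1, 1 - t;
     0, 0, 0, 0, 0, 1, 0, 0, 0;
     0, 0, 0, 0, 0, 0, 1, 0, 0;
     0, 0, 0, 0, 0, 0, 0, 1, 0;
     0, 0, 0, 0, 0, 0, 0, 0, 1]

/-- Rows 5, 6 and 7 are combinations of the other nine, with coefficients polynomial in `t`; thus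
the rank condition holds over any ring containing such a `t`. -/
theorem perlesSF_perlesPoint {R : Type*} [CommRing R] {t : R} (ht : t ^ 2 + t = 1) :
    perlesSF (perlesPoint t) = perlesRowCoeff t *
      (perlesSF (perlesPoint t)).submatrix ![0, 1, 2, 3, 4, 8, 9, 10, 11] id := by
  ext i j
  rw [Matrix.mul_apply]
  simp only [Fin.sum_univ_succ, Matrix.submatrix_apply, id]
  fin_cases i <;> simp [perlesRowCoeff] <;> fin_cases j <;> simp [perlesSF, perlesPoint] <;>
    first
    | ring1 | linear_combination ht | linear_combination -ht
    | linear_combination 2 * ht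

/-- Padding with a zero column and a zero row makes both factors square without changing the
product. -/
theorem det_mul_eq_zero_of_lt {R : Type*} [CommRing R] {n : ℕ}
    (A : Matrix (Fin (n + 1)) (Fin n) R) (B : Matrix (Fin n) (Fin (n + 1)) R) :
    (A * B).det = 0 := by
  have h : A * B = Matrix.of (fun i j => Fin.cons (α := fun _ => R) 0 (A i) j) *
      Matrix.of (fun (i : Fin (n + 1)) j => Fin.cons (α := fun _ => R) 0 (fun k => B k j) i) := by
    ext i j
    simp [Matrix.mul_apply, Fin.sum_univ_succ]
  rw [h, Matrix.det_mul, Matrix.det_eq_zero_of_column_eq_zero 0 (fun i => rfl), zero_mul]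

/-- The only entries are `1`, `t` and `t + 1`, and `t * (t + 1) = 1`. -/
theorem isUnit_perlesPoint {R : Type*} [CommRing R] {t : R} (ht : t ^ 2 + t = 1) (n : Fin 36) :
    IsUnit (perlesPoint t n) := by
  have h : t * (t + 1) = 1 := by linear_combination ht
  have h1 : IsUnit t := .of_mul_eq_one _ h
  have h2 : IsUnit (t + 1) := .of_mul_eq_one_right _ h
  fin_cases n <;> first | exact isUnit_one | exact h1 | exact h2

theorem det_submatrix_eq_zero_of_embedding {ι κ R : Type*} [CommRing R] {m : ℕ}
    {S : Matrix ι κ R} (h : ∀ (r : Fin m ↪ ι) (c : Fin m ↪ κ), (S.submatrix r c).det = 0)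
    (r : Fin m → ι) (c : Fin m → κ) : (S.submatrix r c).det = 0 := by
  by_cases hr : r.Injective
  · by_cases hc : c.Injective
    · exact h ⟨r, hr⟩ ⟨c, hc⟩
    · simp only [Function.Injective, not_forall] at hc
      obtain ⟨a, b, hab, hne⟩ := hc
      exact Matrix.det_zero_of_column_eq hne fun k => by simp [hab]
  · simp only [Function.Injective, not_forall] at hr
    obtain ⟨a, b, hab, hne⟩ := hr
    exact Matrix.det_zero_of_row_eq hne (by ext k; simp [hab])

/-- Vanishing in the localization of `R ⧸ I` at `f` means being killed by a power of `f` modulo `I`.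
Membership in the saturation can thus be tested where `f` is a unit. -/
theorem mem_saturateBy_of_localization {R : Type*} [CommRing R] {I : Ideal R} {f p : R}
    (h : algebraMap (R ⧸ I) (Localization.Away (Ideal.Quotient.mk I f))
      (Ideal.Quotient.mk I p) = 0) : p ∈ saturateBy I f := by
  obtain ⟨⟨_, n, rfl⟩, hn⟩ := (IsLocalization.map_eq_zero_iff
    (Submonoid.powers (Ideal.Quotient.mk I f)) _ _).1 h
  refine ⟨n, Ideal.Quotient.eq_zero_iff_mem.1 ?_⟩
  simpa using hn

theorem perlesGenerators_map {R R' : Type*} [CommRing R] [CommRing R'] (f : R →+* R')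
    (x : Fin 36 → R) : perlesGenerators (fun n => f (x n)) = f '' perlesGenerators x := by
  simp [perlesGenerators, Set.image_insert_eq]

theorem scaledVar_of_mem (k : Type*) [Field k] {n : Fin 36} (h : n ∈ perlesForest) :
    scaledVar k n = 1 := dif_pos h

theorem perlesIdeal_eq (k : Type*) [Field k] :
    perlesIdeal k = Ideal.span (perlesGenerators (scaledVar k)) := by
  apply le_antisymm
  · set J := Ideal.span (perlesGenerators (scaledVar k))
    set q := Ideal.Quotient.mk J
    have hq : (fun n => q (scaledVar k n)) = perlesPoint (q (scaledVar k 35)) ∧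
        q (scaledVar k 35) ^ 2 + q (scaledVar k 35) = 1 := by
      refine eq_perlesPoint (fun n hn => by rw [scaledVar_of_mem k hn, map_one]) ?_
      rw [perlesGenerators_map]
      rintro _ ⟨p, hp, rfl⟩
      exact Ideal.Quotient.eq_zero_iff_mem.2 (Ideal.subset_span hp)
    have hm : minorsIdeal (8 + 2) (perlesSF (scaledVar k)) ≤ J := by
      refine Ideal.span_le.2 ?_
      rintro _ ⟨r, c, rfl⟩
      refine Ideal.Quotient.eq_zero_iff_mem.1 ?_
      rw [RingHom.map_det]
      have h : q.mapMatrix ((perlesSF (scaledVar k)).submatrix r c) =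
          (perlesSF (perlesPoint (q (scaledVar k 35)))).submatrix r c := by
        ext i j
        rw [← hq.1]
        exact (perlesSF_map q (map_zero q) _ _ _).symm
      rw [h, perlesSF_perlesPoint hq.2, Matrix.submatrix_mul _ _ r id c Function.bijective_id]
      exact det_mul_eq_zero_of_lt _ _
    rintro p ⟨n, hn⟩
    refine Ideal.Quotient.eq_zero_iff_mem.1 ?_
    have h0 : q ((∏ n : PerlesVar, MvPolynomial.X n) ^ n * p) = 0 :=
      Ideal.Quotient.eq_zero_iff_mem.2 (hm hn)
    rw [map_mul, map_pow, map_prod] at h0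
    refine (IsUnit.mul_right_eq_zero (IsUnit.pow n ?_)).1 h0
    -- The variables are units modulo `J`, so `J` is already saturated.
    rw [IsUnit.prod_univ_iff]
    intro m
    have : q (MvPolynomial.X m) = perlesPoint (q (scaledVar k 35)) m.1 := by
      rw [← hq.1]
      exact congrArg q (show scaledVar k m.1 = MvPolynomial.X m from dif_neg m.2).symm
    rw [this]
    exact isUnit_perlesPoint hq.2 _
  · rw [Ideal.span_le]
    intro p hp
    refine mem_saturateBy_of_localization ?_
    set I := minorsIdeal (8 + 2) (perlesSF (scaledVar k))
    set f : MvPolynomial PerlesVar k := ∏ n : PerlesVar, MvPolynomial.X n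
    set g := (algebraMap (_ ⧸ I) (Localization.Away (Ideal.Quotient.mk I f))).comp
      (Ideal.Quotient.mk I)
    have hf : IsUnit (g f) := IsLocalization.Away.algebraMap_isUnit (Ideal.Quotient.mk I f)
    change g p = 0
    -- In the localized quotient the minors vanish, and each variable is a unit because it divides
    -- `f`.
    refine perlesGenerators_eq_zero (fun n => g (scaledVar k n))
      (fun n hn => by rw [scaledVar_of_mem k hn, map_one]) ?_ ?_ _
      (by rw [perlesGenerators_map]; exact ⟨p, hp, rfl⟩)
    · intro n
      by_cases hn : n ∈ perlesForest
      · simp [scaledVar_of_mem k hn]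
      · simp only [f, map_prod] at hf
        rw [IsUnit.prod_univ_iff] at hf
        simpa [scaledVar, hn] using hf ⟨n, hn⟩
    · refine det_submatrix_eq_zero_of_embedding fun r c => ?_
      have h : (perlesSF fun n => g (scaledVar k n)).submatrix r c =
          g.mapMatrix ((perlesSF (scaledVar k)).submatrix r c) := by
        ext i j
        exact perlesSF_map g (map_zero g) _ _ _
      rw [h, ← RingHom.map_det, RingHom.comp_apply,
        Ideal.Quotient.eq_zero_iff_mem.2 (show _ ∈ I from Ideal.subset_span ⟨r, c, rfl⟩), map_zero]

theorem sq_add_self_eq_one_iff {K : Type*} [Field K] [CharZero K] {s t : K} (hs : s ^ 2 = 5) :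
    t ^ 2 + t = 1 ↔ t = (-1 + s) / 2 ∨ t = (-1 - s) / 2 := by
  have h : t ^ 2 + t - 1 = (t - (-1 + s) / 2) * (t - (-1 - s) / 2) := by
    linear_combination (1 / 4) * hs
  rw [← sub_eq_zero, h, mul_eq_zero, sub_eq_zero, sub_eq_zero]

theorem mem_zeroLocus_perlesIdeal {a : PerlesVar → ℂ}
    (ha : a ∈ MvPolynomial.zeroLocus ℂ (perlesIdeal ℂ)) :
    a ⟨35, by decide⟩ = (-1 + (√5 : ℝ)) / 2 ∨ a ⟨35, by decide⟩ = (-1 - (√5 : ℝ)) / 2 := by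
  refine (sq_add_self_eq_one_iff (by norm_cast; simp)).1 ?_
  have h := ha (scaledVar ℂ 35 ^ 2 + scaledVar ℂ 35 - 1) (by
    rw [perlesIdeal_eq]
    exact Ideal.subset_span (by simp [perlesGenerators]))
  have h35 : scaledVar ℂ 35 = MvPolynomial.X ⟨35, by decide⟩ := dif_neg _
  simp only [h35, map_sub, map_add, map_pow, MvPolynomial.aeval_X, map_one] at h
  linear_combination h

end SlackModel

namespace SlackModel
open Set

/-! ### Exact arithmetic with the golden ratio -/

/-- The ring `ℤ[φ]`, with `φ² = 1 + φ`. -/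
abbrev ZPhi : Type := QuadraticAlgebra ℤ 1 1

/-- The embedding of `ℤ[φ]` into the real numbers. -/
noncomputable def ZPhi.toReal : ZPhi →ₐ[ℤ] ℝ :=
  QuadraticAlgebra.lift ⟨Real.goldenRatio, by
    rw [← sq, Real.goldenRatio_sq]; simp [add_comm]⟩

theorem ZPhi.toReal_apply (x : ZPhi) : ZPhi.toReal x = x.re + x.im * Real.goldenRatio := by
  simp [ZPhi.toReal, QuadraticAlgebra.lift]

theorem ZPhi.toReal_mk (a b : ℤ) :
    ZPhi.toReal ⟨a, b⟩ = a + b * Real.goldenRatio := ZPhi.toReal_apply _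

/-- A sufficient criterion for positivity in `ℤ[φ]`. -/
def ZPhi.isPos (x : ZPhi) : Bool :=
  decide (0 < 1000 * x.re + 1618 * x.im) && decide (0 < 1000 * x.re + 1619 * x.im)

/-- An element is an affine function of `φ`, and `φ` lies between 1.618 and 1.619; positivity at
both endpoints suffices. -/
theorem ZPhi.toReal_pos {x : ZPhi} (h : x.isPos = true) : 0 < ZPhi.toReal x := by
  simp only [ZPhi.isPos, Bool.and_eq_true, decide_eq_true_eq] at h
  rw [ZPhi.toReal_apply]
  have h1 : (0 : ℝ) < 1000 * x.re + 1618 * x.im := by exact_mod_cast h.1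
  have h2 : (0 : ℝ) < 1000 * x.re + 1619 * x.im := by exact_mod_cast h.2
  have h5 : √5 ^ 2 = 5 := Real.sq_sqrt (by norm_num)
  have h0 : 0 ≤ √5 := Real.sqrt_nonneg 5
  have l : 1618 ≤ 1000 * Real.goldenRatio := by
    rw [Real.goldenRatio]; nlinarith
  have u : 1000 * Real.goldenRatio ≤ 1619 := by
    rw [Real.goldenRatio]; nlinarith
  rcases le_total 0 (x.im : ℝ) with h | h <;> nlinarith

/-- Irrationality of `φ` makes zero tests on integer coordinates exact. -/
theorem ZPhi.toReal_eq_zero_iff {x : ZPhi} : ZPhi.toReal x = 0 ↔ x = 0 := by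
  refine ⟨fun h => ?_, fun h => by rw [h, map_zero]⟩
  rw [ZPhi.toReal_apply] at h
  have him : x.im = 0 := by
    by_contra hne
    exact (Real.goldenRatio_irrational.intCast_mul hne |>.intCast_add x.re).ne_zero h
  rw [him] at h
  exact QuadraticAlgebra.ext (by simpa using h) him

/-! ### Combinatorial data of the Perles polytope -/

/-- The vertices with coordinates in `ℤ[φ]`. -/
def vertexZ : Fin 12 → Fin 8 → ZPhi :=
  ![![0, 0, 0, 0, 0, 0, 0, 0],
    ![1, 0, 0, 0, 0, 0, 0, 0],
    ![0, 1, 0, 0, 0, 0, 0, 0],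
    ![0, 0, 1, 0, 0, 0, 0, 0],
    ![0, 0, 0, 1, 0, 0, 0, 0],
    ![⟨-2, 1⟩, ⟨2, -1⟩, ⟨2, -1⟩, ⟨-2, 1⟩, 1, 0, 0, ⟨-3, 2⟩],
    ![1, -1, 0, ⟨1, -1⟩, 0, ⟨0, 1⟩, 0, 1],
    ![⟨0, -1⟩, -1, ⟨-1, -1⟩, 1, 0, 0, ⟨1, 1⟩, 1],
    ![0, 0, 0, 0, 1, 0, 0, 0],
    ![0, 0, 0, 0, 0, 1, 0, 0],
    ![0, 0, 0, 0, 0, 0, 1, 0],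
    ![0, 0, 0, 0, 0, 0, 0, 1]]

theorem perlesVertex_eq (i : Fin 12) (k : Fin 8) :
    perlesVertex i k = ZPhi.toReal (vertexZ i k) := by
  fin_cases i <;> fin_cases k <;> simp [perlesVertex, vertexZ, ZPhi.toReal_mk] <;> ring

/-- The facets, each given by the nonzero values of its slack function on the vertices. -/
def facetData : Fin 34 → List (Fin 12 × ZPhi) :=
  ![
    [(5, ⟨1, 0⟩), (8, ⟨1, 0⟩)],
    [(6, ⟨0, 1⟩), (9, ⟨1, 0⟩)],
    [(7, ⟨1, 1⟩), (10, ⟨1, 0⟩)],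
    [(0, ⟨0, 1⟩), (1, ⟨0, 1⟩), (8, ⟨1, 0⟩)],
    [(0, ⟨0, 1⟩), (3, ⟨1, 0⟩), (9, ⟨1, 0⟩)],
    [(0, ⟨1, 0⟩), (7, ⟨1, 1⟩), (11, ⟨1, 0⟩)],
    [(1, ⟨1, 0⟩), (2, ⟨1, 0⟩), (10, ⟨1, 0⟩)],
    [(1, ⟨1, 0⟩), (4, ⟨0, 1⟩), (8, ⟨1, 0⟩)],
    [(1, ⟨-1, 1⟩), (6, ⟨0, 1⟩), (11, ⟨1, 0⟩)],
    [(2, ⟨1, 0⟩), (4, ⟨1, 0⟩), (9, ⟨1, 0⟩)],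
    [(2, ⟨1, 0⟩), (5, ⟨-1, 1⟩), (11, ⟨1, 0⟩)],
    [(3, ⟨1, 0⟩), (4, ⟨0, 1⟩), (11, ⟨1, 0⟩)],
    [(3, ⟨1, 0⟩), (5, ⟨2, -1⟩), (10, ⟨1, 0⟩)],
    [(0, ⟨1, 0⟩), (1, ⟨2, -1⟩), (2, ⟨1, 0⟩), (9, ⟨1, 0⟩)],
    [(0, ⟨1, 0⟩), (1, ⟨1, 0⟩), (2, ⟨1, 0⟩), (11, ⟨1, 0⟩)],
    [(0, ⟨-1, 1⟩), (1, ⟨-1, 1⟩), (3, ⟨1, 0⟩), (10, ⟨1, 0⟩)],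
    [(0, ⟨0, 1⟩), (1, ⟨-1, 1⟩), (3, ⟨1, 0⟩), (11, ⟨1, 0⟩)],
    [(0, ⟨-1, 1⟩), (2, ⟨1, 0⟩), (5, ⟨-3, 2⟩), (9, ⟨1, 0⟩)],
    [(0, ⟨1, 0⟩), (2, ⟨-1, 1⟩), (7, ⟨1, 0⟩), (9, ⟨1, 0⟩)],
    [(0, ⟨1, 0⟩), (3, ⟨1, 0⟩), (5, ⟨2, -1⟩), (11, ⟨1, 0⟩)],
    [(0, ⟨0, 1⟩), (7, ⟨1, 1⟩), (8, ⟨2, -1⟩), (9, ⟨1, 0⟩)],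
    [(1, ⟨-1, 1⟩), (2, ⟨1, 0⟩), (4, ⟨1, 0⟩), (11, ⟨1, 0⟩)],
    [(1, ⟨2, -1⟩), (3, ⟨1, 0⟩), (4, ⟨-1, 1⟩), (10, ⟨1, 0⟩)],
    [(1, ⟨-1, 1⟩), (3, ⟨-1, 1⟩), (6, ⟨-1, 1⟩), (10, ⟨1, 0⟩)],
    [(1, ⟨0, 1⟩), (6, ⟨0, 1⟩), (8, ⟨-1, 1⟩), (10, ⟨1, 0⟩)],
    [(2, ⟨2, -1⟩), (4, ⟨1, 0⟩), (7, ⟨0, 1⟩), (11, ⟨1, 0⟩)],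
    [(2, ⟨1, 1⟩), (5, ⟨1, 0⟩), (9, ⟨0, 1⟩), (10, ⟨1, 0⟩)],
    [(3, ⟨1, 0⟩), (4, ⟨1, 1⟩), (8, ⟨-1, 1⟩), (9, ⟨1, 0⟩)],
    [(3, ⟨0, 1⟩), (4, ⟨0, 1⟩), (9, ⟨-1, 1⟩), (10, ⟨1, 0⟩)],
    [(3, ⟨2, -1⟩), (5, ⟨2, -1⟩), (6, ⟨1, 0⟩), (11, ⟨1, 0⟩)],
    [(4, ⟨-1, 1⟩), (6, ⟨-1, 1⟩), (7, ⟨0, 1⟩), (11, ⟨1, 0⟩)],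
    [(4, ⟨1, 1⟩), (7, ⟨1, 1⟩), (8, ⟨1, 0⟩), (9, ⟨1, 0⟩)],
    [(4, ⟨0, 1⟩), (7, ⟨1, 1⟩), (8, ⟨2, -1⟩), (11, ⟨1, 0⟩)],
    [(5, ⟨-3, 2⟩), (6, ⟨1, 0⟩), (7, ⟨1, 0⟩), (11, ⟨1, 0⟩)]]

/-- The value of the slack function of the facet `j` at the vertex `i`. -/
def facetSlack (j : Fin 34) (i : Fin 12) : ZPhi := ((facetData j).lookup i).getD 0

/-- The vertices `e₁, …, e₈`. -/
def unitIndex : Fin 8 → Fin 12 := ![1, 2, 3, 4, 8, 9, 10, 11]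

/-- The Gale dual: a basis of the affine dependences of the vertices. -/
def gale : Fin 12 → Fin 3 → ZPhi :=
  ![![⟨-3, 2⟩, ⟨1, 0⟩, ⟨0, -1⟩],
    ![⟨2, -1⟩, ⟨-1, 0⟩, ⟨0, 1⟩],
    ![⟨-2, 1⟩, ⟨1, 0⟩, ⟨1, 0⟩],
    ![⟨-2, 1⟩, ⟨0, 0⟩, ⟨1, 1⟩],
    ![⟨2, -1⟩, ⟨-1, 1⟩, ⟨-1, 0⟩],
    ![⟨1, 0⟩, ⟨0, 0⟩, ⟨0, 0⟩],
    ![⟨0, 0⟩, ⟨1, 0⟩, ⟨0, 0⟩],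
    ![⟨0, 0⟩, ⟨0, 0⟩, ⟨1, 0⟩],
    ![⟨-1, 0⟩, ⟨0, 0⟩, ⟨0, 0⟩],
    ![⟨0, 0⟩, ⟨0, -1⟩, ⟨0, 0⟩],
    ![⟨0, 0⟩, ⟨0, 0⟩, ⟨-1, -1⟩],
    ![⟨3, -2⟩, ⟨-1, 0⟩, ⟨-1, 0⟩]]

/-- Directions in which the Gale vectors of a maximal non-spanning set of vertices are positive. -/
def galeFunctional : Fin 21 → Fin 3 → ℤ :=
  ![
    ![-1, -1, 1], ![-1, 1, -1], ![-1, 1, 1], ![-2, -1, -2], ![1, -2, 1], ![1, -1, 2],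
    ![1, 1, -2], ![1, 2, -1], ![2, -2, -1], ![2, 2, 1], ![-2, 3, 1], ![5, -1, 1],
    ![-7, -7, -1], ![-7, -1, -1], ![-7, 1, -1], ![-7, 3, -1], ![7, 1, -1], ![-8, -1, -2],
    ![8, -3, 1], ![-9, 1, 1], ![12, -1, 1]]

/-- The affine dependence given by a coefficient vector of the Gale dual. -/
def galeComb {R : Type*} [CommRing R] (f : ZPhi →+* R) (y : Fin 3 → R) (i : Fin 12) : R :=
  ∑ t, y t * f (gale i t)

/-- Supports of the facet slack functions as bit masks. -/
def facetMasks : List ℕ :=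
  [
    288, 576, 1152, 259, 521, 2177, 1030, 274, 2114, 532, 2084, 2072, 1064, 519, 2055, 1035,
    2059, 549, 645, 2089, 897, 2070, 1050, 1098, 1346, 2196, 1572, 792, 1560, 2152, 2256, 912,
    2448, 2272]

/-- Positivity sets of the vectors `galeFunctional` as bit masks. -/
def positiveMasks : List ℕ :=
  [
    2958, 3413, 462, 3857, 2730, 686, 3185, 1141, 3635, 255, 477, 698, 3850, 3852, 3405, 1373,
    1139, 3845, 2738, 2508, 691]

/-- A finite certificate of Farkas type over all 4096 vertex sets, encoded as `64 * a + b`: the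
first alternative finds a facet support inside the set, the second an affine dependence positive on
the whole set. -/
theorem masks_cover : ∀ a < 64, ∀ b < 64,
    (facetMasks.any fun c => (64 * a + b) &&& c == c) ||
    (positiveMasks.any fun c => (64 * a + b) &&& c == 64 * a + b) := by
  decide +kernel

theorem facetMasks_spec : ∀ (j : Fin 34) (i : Fin 12),
    (facetMasks.getD j 0).testBit i = decide (facetSlack j i ≠ 0) := by
  decide +kernel

theorem positiveMasks_spec : ∀ (q : Fin 21) (i : Fin 12), (positiveMasks.getD q 0).testBit i →
    (galeComb (RingHom.id ZPhi) (fun t => (galeFunctional q t : ZPhi)) i).isPos = true := by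
  decide +kernel

/-- The origin and the unit vectors determine an affine function by interpolation; only the vertices
5, 6 and 7 impose a condition. -/
theorem facetSlack_affine : ∀ (j : Fin 34) (i : Fin 12), facetSlack j i =
    facetSlack j 0 - ∑ k, (facetSlack j 0 - facetSlack j (unitIndex k)) * vertexZ i k := by
  decide +kernel

theorem facetSlack_nonneg : ∀ (j : Fin 34) (i : Fin 12), facetSlack j i ≠ 0 →
    (facetSlack j i).isPos = true := by
  decide +kernel

theorem facetSlack_antichain : ∀ j j' : Fin 34,
    (∀ i, facetSlack j' i ≠ 0 → facetSlack j i ≠ 0) → j' = j := by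
  decide +kernel

/-- The facets through a vertex have no other listed point in common; extremality and injectivity of
the vertex list rest on this. -/
theorem facetSlack_vertex : ∀ i k : Fin 12,
    (∀ j, facetSlack j i = 0 → facetSlack j k = 0) → k = i := by
  decide +kernel

theorem gale_sum : ∀ t, ∑ i, gale i t = 0 := by decide +kernel

theorem gale_vertex : ∀ t k, ∑ i, gale i t * vertexZ i k = 0 := by decide +kernel

theorem card_nonincident :
    (Finset.univ.filter fun p : Fin 12 × Fin 34 => facetSlack p.2 p.1 ≠ 0).card = 120 := by
  decide +kernel

/-- The nonsimplicial facets. -/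
def nonsimplicial : Fin 13 → Fin 34 := Fin.castLE (by decide)

theorem facetSlack_nonsimplicial : ∀ (j : Fin 13) (i : Fin 12),
    facetSlack (nonsimplicial j) i = 0 ↔ perlesIndex i j = 0 := by
  decide +kernel

/-- A pair of vertices whose Gale vectors span a plane containing the Gale vectors outside the
facet `j`. -/
def galePlane : Fin 13 → Fin 12 × Fin 12 :=
  ![(5, 6), (6, 7), (7, 5), (0, 1), (0, 3), (0, 7), (1, 2), (1, 4), (1, 6), (2, 4), (2, 5), (3, 4),
    (3, 5)]

/-- A normal vector of `galePlane`. -/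
def galeNormal (j : Fin 13) : Fin 3 → ZPhi :=
  crossProduct (gale (galePlane j).1) (gale (galePlane j).2)

/-- The outside Gale vectors lie in a plane, and its normal gives a nonzero affine dependence
supported on the facet. -/
theorem galeNormal_spec : ∀ j : Fin 13,
    (∀ i, facetSlack (nonsimplicial j) i ≠ 0 →
      galeComb (RingHom.id ZPhi) (galeNormal j) i = 0) ∧
    ∃ i, galeComb (RingHom.id ZPhi) (galeNormal j) i ≠ 0 := by
  decide +kernel

/-- Three vertices outside a simplicial facet, whose Gale vectors are a basis. -/
def galeBasis (j : Fin 34) (u : Fin 3) : Fin 12 := ((facetData j).getD u (0, 0)).1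

theorem galeBasis_spec : ∀ j : Fin 34, 13 ≤ j →
    (∀ u, facetSlack j (galeBasis j u) ≠ 0) ∧
    (Matrix.of fun u t => gale (galeBasis j u) t).det ≠ 0 := by
  simp only [Matrix.det_fin_three, Matrix.of_apply]
  decide +kernel

end SlackModel

namespace SlackModel
open Set

/-! ### Faces of the Perles polytope -/

theorem isPolytope_perles : IsPolytope perles := ⟨_, finite_range _, rfl⟩

theorem perlesVertex_mem (i : Fin 12) : perlesVertex i ∈ perles :=
  subset_convexHull ℝ _ (mem_range_self i)

theorem slack_nonneg_of_vertices {d : ℕ} {ι : Type*} {v : ι → Fin d → ℝ} {b : ℝ} {α : Fin d → ℝ}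
    (h : ∀ i, 0 ≤ b - α ⬝ᵥ v i) : ∀ x ∈ convexHull ℝ (range v), 0 ≤ b - α ⬝ᵥ x := by
  intro x hx
  have : x ∈ {y | dotProductBilin ℝ ℝ α y ≤ b} := by
    refine convexHull_min ?_ (convex_halfSpace_le (dotProductBilin ℝ ℝ α).isLinear _) hx
    rintro _ ⟨i, rfl⟩
    exact sub_nonneg.1 (h i)
  exact sub_nonneg.2 this

/-- The coefficient vector of the slack function of a facet. -/
noncomputable def facetNormal (j : Fin 34) (k : Fin 8) : ℝ :=
  ZPhi.toReal (facetSlack j 0 - facetSlack j (unitIndex k))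

theorem toReal_facetSlack (j : Fin 34) (i : Fin 12) :
    ZPhi.toReal (facetSlack j i) =
      ZPhi.toReal (facetSlack j 0) - facetNormal j ⬝ᵥ perlesVertex i := by
  conv_lhs => rw [facetSlack_affine]
  simp only [map_sub, map_sum, map_mul, dotProduct, facetNormal, perlesVertex_eq]

/-- The facets of the Perles polytope. -/
def perlesFacet (j : Fin 34) : Set (Fin 8 → ℝ) :=
  {x ∈ perles | ZPhi.toReal (facetSlack j 0) - facetNormal j ⬝ᵥ x = 0}

theorem isExposed_perlesFacet (j : Fin 34) : IsExposed ℝ perles (perlesFacet j) := by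
  refine isExposed_of_slack (slack_nonneg_of_vertices fun i => ?_)
  rw [← toReal_facetSlack]
  by_cases h : facetSlack j i = 0
  · rw [h, map_zero]
  · exact (ZPhi.toReal_pos (facetSlack_nonneg j i h)).le

theorem perlesVertex_mem_perlesFacet {i : Fin 12} {j : Fin 34} :
    perlesVertex i ∈ perlesFacet j ↔ facetSlack j i = 0 := by
  rw [← ZPhi.toReal_eq_zero_iff, toReal_facetSlack]
  exact and_iff_right (perlesVertex_mem i)

theorem isExposed_inter_biInter {d : ℕ} {Q : Set (Fin d → ℝ)} {κ : Type*} [Finite κ]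
    (F : κ → Set (Fin d → ℝ)) (hF : ∀ j, IsExposed ℝ Q (F j)) (T : Set κ) :
    IsExposed ℝ Q (Q ∩ ⋂ j ∈ T, F j) := by
  induction T, T.toFinite using Set.Finite.induction_on with
  | empty => simpa using IsExposed.refl Q
  | @insert a s _ _ ih =>
    rw [biInter_insert, inter_left_comm]
    exact (hF a).inter ih

theorem perlesVertex_injective : Function.Injective perlesVertex := by
  intro i k hik
  refine (facetSlack_vertex i k fun j hj => ?_).symm
  rw [← perlesVertex_mem_perlesFacet] at hj ⊢
  rwa [← hik]

/-- The facets through a listed point meet in a nonempty face, which has an extreme point. That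
point is in the list, and by `facetSlack_vertex` it is the given one. -/
theorem range_perlesVertex : range perlesVertex = perles.extremePoints ℝ := by
  refine subset_antisymm ?_ extremePoints_convexHull_subset
  rintro _ ⟨i, rfl⟩
  have hA := isExposed_inter_biInter perlesFacet isExposed_perlesFacet
    {j | perlesVertex i ∈ perlesFacet j}
  have hi : perlesVertex i ∈ perles ∩ ⋂ j ∈ {j | perlesVertex i ∈ perlesFacet j},
      perlesFacet j := ⟨perlesVertex_mem i, mem_iInter₂.2 fun j hj => hj⟩
  have hne : ((perles ∩ ⋂ j ∈ {j | perlesVertex i ∈ perlesFacet j}, perlesFacet j) ∩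
      perles.extremePoints ℝ).Nonempty := by
    rw [isPolytope_perles.extremePoints_exposed hA] at hi
    exact convexHull_nonempty_iff.1 ⟨_, hi⟩
  obtain ⟨x, hx, hxe⟩ := hne
  obtain ⟨k, rfl⟩ := extremePoints_convexHull_subset hxe
  have : k = i := facetSlack_vertex i k fun j hj =>
    perlesVertex_mem_perlesFacet.1 (mem_iInter₂.1 hx.2 j (perlesVertex_mem_perlesFacet.2 hj))
  rwa [this] at hxe

theorem affineSpan_perles : affineSpan ℝ perles = ⊤ := by
  rw [AffineSubspace.affineSpan_eq_top_iff_vectorSpan_eq_top_of_nonempty ℝ _ _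
    ⟨_, perlesVertex_mem 0⟩, eq_top_iff, ← (Pi.basisFun ℝ (Fin 8)).span_eq, Submodule.span_le]
  rintro _ ⟨k, rfl⟩
  have h : perlesVertex (unitIndex k) -ᵥ perlesVertex 0 = Pi.basisFun ℝ (Fin 8) k := by
    funext m
    fin_cases k <;> fin_cases m <;> simp [perlesVertex, unitIndex]
  rw [← h]
  exact vsub_mem_vectorSpan ℝ (perlesVertex_mem _) (perlesVertex_mem _)

theorem galeComb_toReal (y : Fin 3 → ZPhi) (i : Fin 12) :
    galeComb (ZPhi.toReal : ZPhi →+* ℝ) (fun t => ZPhi.toReal (y t)) i =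
      ZPhi.toReal (galeComb (RingHom.id ZPhi) y i) := by
  simp [galeComb]

theorem sum_galeComb (y : Fin 3 → ℝ) : ∑ i, galeComb (ZPhi.toReal : ZPhi →+* ℝ) y i = 0 := by
  simp only [galeComb]
  rw [Finset.sum_comm]
  refine Finset.sum_eq_zero fun t _ => ?_
  rw [← Finset.mul_sum, ← map_sum, gale_sum, map_zero, mul_zero]

theorem sum_galeComb_smul (y : Fin 3 → ℝ) :
    ∑ i, galeComb (ZPhi.toReal : ZPhi →+* ℝ) y i • perlesVertex i = 0 := by
  funext k
  simp only [galeComb, Finset.sum_apply, Pi.smul_apply, smul_eq_mul, perlesVertex_eq,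
    Finset.sum_mul, Pi.zero_apply]
  rw [Finset.sum_comm]
  refine Finset.sum_eq_zero fun t _ => ?_
  have h := congrArg ZPhi.toReal (gale_vertex t k)
  rw [map_sum, map_zero] at h
  simp only [map_mul] at h
  simp only [mul_assoc, ← Finset.mul_sum]
  rw [show ∑ i, (ZPhi.toReal : ZPhi →+* ℝ) (gale i t) * ZPhi.toReal (vertexZ i k) = 0 from h,
    mul_zero]

/-- Affine dependences are orthogonal to the values of affine functions. -/
theorem sum_galeComb_mul_slack (y : Fin 3 → ℝ) (b : ℝ) (α : Fin 8 → ℝ) :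
    ∑ i, galeComb (ZPhi.toReal : ZPhi →+* ℝ) y i * (b - α ⬝ᵥ perlesVertex i) = 0 := by
  have h := congrArg (α ⬝ᵥ ·) (sum_galeComb_smul y)
  simp only [dotProduct_sum, dotProduct_smul, dotProduct_zero, smul_eq_mul] at h
  simp only [mul_sub, Finset.sum_sub_distrib, h, ← Finset.sum_mul, sum_galeComb, zero_mul, sub_zero]

/-- The support of every nonzero slack function contains the support of a facet slack function. -/
theorem exists_facetSlack_support {b : ℝ} {α : Fin 8 → ℝ}
    (h : ∀ i, 0 ≤ b - α ⬝ᵥ perlesVertex i) {i₀ : Fin 12} (h₀ : b - α ⬝ᵥ perlesVertex i₀ ≠ 0) :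
    ∃ j, ∀ i, facetSlack j i ≠ 0 → b - α ⬝ᵥ perlesVertex i ≠ 0 := by
  classical
  set s : Fin 12 → ℝ := fun i => b - α ⬝ᵥ perlesVertex i
  set m := Nat.ofBits fun i : Fin 12 => decide (s i ≠ 0)
  have hm : m < 2 ^ 12 := Nat.ofBits_lt_two_pow _
  have hbit : ∀ i : Fin 12, m.testBit i = decide (s i ≠ 0) := fun i =>
    Nat.testBit_ofBits_lt _ _ i.2
  have hc := masks_cover (m / 64) (by omega) (m % 64) (by omega)
  rw [Nat.div_add_mod, Bool.or_eq_true, List.any_eq_true, List.any_eq_true] at hc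
  rcases hc with ⟨c, hc, hmc⟩ | ⟨c, hc, hmc⟩
  · obtain ⟨n, hn, rfl⟩ := List.mem_iff_getElem.1 hc
    refine ⟨⟨n, hn⟩, fun i hi => ?_⟩
    have h1 := facetMasks_spec ⟨n, hn⟩ i
    rw [List.getD_eq_getElem _ _ hn, decide_eq_true hi, ← beq_iff_eq.1 hmc, Nat.testBit_land,
      Bool.and_eq_true, hbit] at h1
    exact of_decide_eq_true h1.1
  -- The dependence is positive on the support of `s`, so its pairing with `s ≥ 0` is positive
  -- because of `i₀`, although it must vanish.
  · exfalso
    obtain ⟨n, hn, rfl⟩ := List.mem_iff_getElem.1 hc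
    have hpos : ∀ i, s i ≠ 0 → 0 < galeComb (ZPhi.toReal : ZPhi →+* ℝ)
        (fun t => ZPhi.toReal (galeFunctional ⟨n, hn⟩ t : ZPhi)) i := by
      intro i hi
      rw [galeComb_toReal]
      refine ZPhi.toReal_pos (positiveMasks_spec ⟨n, hn⟩ i ?_)
      have h1 := hbit i
      rw [decide_eq_true hi, ← beq_iff_eq.1 hmc, Nat.testBit_land, Bool.and_eq_true] at h1
      rw [List.getD_eq_getElem _ _ hn]
      exact h1.2
    have hsum := sum_galeComb_mul_slack
      (fun t => ZPhi.toReal (galeFunctional ⟨n, hn⟩ t : ZPhi)) b α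
    refine (Finset.sum_pos' (fun i _ => ?_) ⟨i₀, Finset.mem_univ _, ?_⟩).ne' hsum
    · by_cases hi : s i = 0
      · exact (mul_eq_zero_of_right _ hi).ge
      · exact (mul_pos (hpos i hi) (lt_of_le_of_ne (h i) (Ne.symm hi))).le
    · exact mul_pos (hpos i₀ h₀) (lt_of_le_of_ne (h i₀) (Ne.symm h₀))

theorem perlesFacet_subset_iff {A B : Set (Fin 8 → ℝ)} (hA : IsExposed ℝ perles A)
    (hB : IsExposed ℝ perles B) :
    A ⊆ B ↔ ∀ i, perlesVertex i ∈ A → perlesVertex i ∈ B := by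
  rw [isPolytope_perles.exposed_subset_iff hA hB, ← range_perlesVertex]
  simp

theorem exists_subset_perlesFacet {A : Set (Fin 8 → ℝ)} (hA : IsExposed ℝ perles A)
    (hne : A ≠ perles) : ∃ j, A ⊆ perlesFacet j := by
  obtain ⟨b, α, hv, rfl⟩ := exists_slack_of_isExposed hA
  obtain ⟨i₀, h₀⟩ : ∃ i, b - α ⬝ᵥ perlesVertex i ≠ 0 := by
    by_contra! hcon
    refine hne (subset_antisymm (sep_subset _ _)
      ((perlesFacet_subset_iff (IsExposed.refl _) hA).2 fun i hi => ⟨hi, hcon i⟩))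
  obtain ⟨j, hj⟩ := exists_facetSlack_support (fun i => hv _ (perlesVertex_mem i)) h₀
  refine ⟨j, (perlesFacet_subset_iff hA (isExposed_perlesFacet j)).2 fun i hi => ?_⟩
  rw [perlesVertex_mem_perlesFacet]
  by_contra h
  exact hj i h hi.2

theorem perlesFacet_le_iff {j j' : Fin 34} (h : perlesFacet j ⊆ perlesFacet j') : j' = j := by
  refine facetSlack_antichain j j' fun i hi h0 => hi ?_
  exact perlesVertex_mem_perlesFacet.1 (h (perlesVertex_mem_perlesFacet.2 h0))

theorem perlesFacet_injective : Function.Injective perlesFacet := fun _ _ h =>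
  (perlesFacet_le_iff h.subset).symm

theorem facetSlack_ne_zero : ∀ j : Fin 34, ∃ i, facetSlack j i ≠ 0 := by decide +kernel

theorem perlesFacet_ne (j : Fin 34) : perlesFacet j ≠ perles := by
  intro h
  obtain ⟨i, hi⟩ := facetSlack_ne_zero j
  exact hi (perlesVertex_mem_perlesFacet.1 (h ▸ perlesVertex_mem i))

theorem isFacet_perles_iff {B : Set (Fin 8 → ℝ)} :
    IsFacet perles B ↔ B ∈ range perlesFacet := by
  constructor
  · rintro ⟨⟨hB, hne⟩, hmax⟩
    obtain ⟨j, hj⟩ := exists_subset_perlesFacet hB hne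
    exact ⟨j, subset_antisymm (hmax ⟨isExposed_perlesFacet j, perlesFacet_ne j⟩ hj) hj⟩
  · rintro ⟨j, rfl⟩
    refine ⟨⟨isExposed_perlesFacet j, perlesFacet_ne j⟩, fun A hA hle => ?_⟩
    obtain ⟨j', hj'⟩ := exists_subset_perlesFacet hA.1 hA.2
    rwa [perlesFacet_le_iff (hle.trans hj')] at hj'

theorem ncard_facets : {B | IsFacet perles B}.ncard = 34 := by
  have h : {B | IsFacet perles B} = perlesFacet '' univ := by
    ext B; rw [image_univ]; exact isFacet_perles_iff
  rw [h, ncard_image_of_injective _ perlesFacet_injective, ncard_univ, Nat.card_eq_fintype_card,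
    Fintype.card_fin]

theorem ncard_nonincident :
    {p : (Fin 8 → ℝ) × Set (Fin 8 → ℝ) |
      p.1 ∈ perles.extremePoints ℝ ∧ IsFacet perles p.2 ∧ p.1 ∉ p.2}.ncard = 120 := by
  have h : {p : (Fin 8 → ℝ) × Set (Fin 8 → ℝ) |
      p.1 ∈ perles.extremePoints ℝ ∧ IsFacet perles p.2 ∧ p.1 ∉ p.2} =
      Prod.map perlesVertex perlesFacet ''
        (Finset.univ.filter fun p : Fin 12 × Fin 34 => facetSlack p.2 p.1 ≠ 0 : Finset _) := by
    ext ⟨x, B⟩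
    constructor
    · rintro ⟨hx, hB, hxB⟩
      dsimp only at hx hB hxB
      rw [← range_perlesVertex] at hx
      obtain ⟨i, rfl⟩ := hx
      obtain ⟨j, rfl⟩ := isFacet_perles_iff.1 hB
      exact ⟨(i, j), by simpa [perlesVertex_mem_perlesFacet] using hxB, rfl⟩
    · rintro ⟨⟨i, j⟩, hij, heq⟩
      obtain ⟨rfl, rfl⟩ := Prod.mk.inj heq
      refine ⟨range_perlesVertex ▸ mem_range_self i, isFacet_perles_iff.2 ⟨j, rfl⟩, ?_⟩
      simpa [perlesVertex_mem_perlesFacet] using hij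
  rw [h, ncard_image_of_injective _ (perlesVertex_injective.prodMap perlesFacet_injective),
    ncard_coe_finset, card_nonincident]

/-! ### Simplicial facets -/

theorem isSimplex_iff_of_range {d : ℕ} {B : Set (Fin d → ℝ)} {ι : Type*} {u : ι → Fin d → ℝ}
    (hu : Function.Injective u) (hB : B.extremePoints ℝ = range u) :
    IsSimplex B ↔ AffineIndependent ℝ u := by
  rw [IsSimplex, hB]
  exact (affineIndependent_equiv (Equiv.ofInjective u hu)).symm

/-- Extension by zero identifies the affine dependences of the facet's vertices with those of all
twelve vertices that vanish outside the facet. -/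
theorem isSimplex_perlesFacet_iff (j : Fin 34) : IsSimplex (perlesFacet j) ↔
    ∀ w : Fin 12 → ℝ, (∀ i, facetSlack j i ≠ 0 → w i = 0) → ∑ i, w i = 0 →
      ∑ i, w i • perlesVertex i = 0 → w = 0 := by
  classical
  have hext : (perlesFacet j).extremePoints ℝ =
      range fun i : {i // facetSlack j i = 0} => perlesVertex i := by
    rw [(isExposed_perlesFacet j).isExtreme.extremePoints_eq, ← range_perlesVertex]
    ext x
    constructor
    · rintro ⟨hx, i, rfl⟩
      exact ⟨⟨i, perlesVertex_mem_perlesFacet.1 hx⟩, rfl⟩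
    · rintro ⟨⟨i, hi⟩, rfl⟩
      exact ⟨perlesVertex_mem_perlesFacet.2 hi, i, rfl⟩
  rw [isSimplex_iff_of_range (perlesVertex_injective.comp Subtype.val_injective) hext,
    affineIndependent_iff_of_fintype]
  have hsub : ∀ {M : Type} [AddCommMonoid M] (f : Fin 12 → M),
      (∀ i, facetSlack j i ≠ 0 → f i = 0) →
      ∑ i : {i // facetSlack j i = 0}, f i = ∑ i, f i := by
    intro M _ f hf
    rw [← Finset.sum_subtype (Finset.univ.filter fun i => facetSlack j i = 0) (by simp) f]
    exact Finset.sum_filter_of_ne fun i _ hi => by_contra fun h => hi (hf i h)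
  constructor
  · intro h w hw h1 h2
    have h3 := h (fun i => w i) ((hsub w hw).trans h1) (by
      rw [Finset.weightedVSub_eq_linear_combination _ ((hsub w hw).trans h1)]
      exact (hsub (fun i => w i • perlesVertex i) fun i hi => by rw [hw i hi, zero_smul]).trans h2)
    funext i
    by_cases hi : facetSlack j i = 0
    · exact h3 ⟨i, hi⟩
    · exact hw i hi
  · intro h w h1 h2
    rw [Finset.weightedVSub_eq_linear_combination _ h1] at h2
    let W : Fin 12 → ℝ := fun i => if hi : facetSlack j i = 0 then w ⟨i, hi⟩ else 0
    have hW : ∀ i : {i // facetSlack j i = 0}, W i = w i := fun i => dif_pos i.2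
    have hW0 : ∀ i, facetSlack j i ≠ 0 → W i = 0 := fun i hi => dif_neg hi
    have h3 := h W hW0 (by rw [← hsub W hW0]; simpa only [hW] using h1) (by
      rw [← hsub (fun i => W i • perlesVertex i) fun i hi => by rw [hW0 i hi, zero_smul]]
      simpa only [hW, Function.comp_apply] using h2)
    intro i
    rw [← hW, h3, Pi.zero_apply]

/-- The origin and the unit vectors are affinely independent, so the coefficients at the vertices 5,
6 and 7 determine a dependence; there the Gale vectors are the standard basis. -/
theorem eq_galeComb_of_dependence {w : Fin 12 → ℝ} (h1 : ∑ i, w i = 0)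
    (h2 : ∑ i, w i • perlesVertex i = 0) :
    w = galeComb (ZPhi.toReal : ZPhi →+* ℝ) ![w 5, w 6, w 7] := by
  have hk : ∀ k, ∑ i, w i * perlesVertex i k = 0 := fun k => by
    simpa [Finset.sum_apply] using congrFun h2 k
  simp only [Fin.sum_univ_succ] at hk h1
  have e0 := hk 0; have e1 := hk 1; have e2 := hk 2; have e3 := hk 3
  have e4 := hk 4; have e5 := hk 5; have e6 := hk 6; have e7 := hk 7
  simp [perlesVertex] at e0 e1 e2 e3 e4 e5 e6 e7 h1
  funext i
  fin_cases i <;> simp [galeComb, Fin.sum_univ_three, gale, ZPhi.toReal_mk]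
  · linear_combination h1 - e0 - e1 - e2 - e3 - e4 - e5 - e6 - e7
  all_goals first
    | linear_combination e0 | linear_combination e1 | linear_combination e2
    | linear_combination e3 | linear_combination e4 | linear_combination e5
    | linear_combination e6 | linear_combination e7

theorem isSimplex_perlesFacet {j : Fin 34} (hj : 13 ≤ j) : IsSimplex (perlesFacet j) := by
  rw [isSimplex_perlesFacet_iff]
  intro w hw h1 h2
  have hy := eq_galeComb_of_dependence h1 h2
  obtain ⟨hb, hdet⟩ := galeBasis_spec j hj
  have hdet' : (Matrix.of fun u t => ZPhi.toReal (gale (galeBasis j u) t)).det ≠ 0 := by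
    rw [show (Matrix.of fun u t => ZPhi.toReal (gale (galeBasis j u) t)) =
      (ZPhi.toReal : ZPhi →+* ℝ).mapMatrix (Matrix.of fun u t => gale (galeBasis j u) t) from rfl,
      ← RingHom.map_det]
    exact fun h => hdet (ZPhi.toReal_eq_zero_iff.1 h)
  have hzero : ![w 5, w 6, w 7] = 0 := by
    refine Matrix.eq_zero_of_mulVec_eq_zero hdet' ?_
    funext u
    have hu := congrFun hy (galeBasis j u)
    rw [hw _ (hb u)] at hu
    rw [Pi.zero_apply, hu]
    simp only [Matrix.mulVec, dotProduct, Matrix.of_apply, galeComb]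
    exact Finset.sum_congr rfl fun t _ => mul_comm _ _
  rw [hy, hzero]
  funext i
  simp [galeComb]

theorem not_isSimplex_perlesFacet (j : Fin 13) :
    ¬ IsSimplex (perlesFacet (nonsimplicial j)) := by
  rw [isSimplex_perlesFacet_iff]
  intro h
  obtain ⟨h1, i, hi⟩ := galeNormal_spec j
  have h0 := h (galeComb (ZPhi.toReal : ZPhi →+* ℝ) fun t => ZPhi.toReal (galeNormal j t))
    (fun i hi => by rw [galeComb_toReal, h1 i hi, map_zero]) (sum_galeComb _)
    (sum_galeComb_smul _)
  refine hi (ZPhi.toReal_eq_zero_iff.1 ?_)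
  rw [← galeComb_toReal, h0, Pi.zero_apply]

/-- The nonsimplicial facets as faces. -/
def perlesFace (j : Fin 13) : Face perles :=
  ⟨perlesFacet (nonsimplicial j), isExposed_perlesFacet _⟩

theorem perlesFace_injective : Function.Injective perlesFace := fun _ _ h =>
  Fin.castLE_injective (by decide) (perlesFacet_injective (congrArg Subtype.val h))

theorem range_perlesFace :
    range (fun j => (perlesFace j).1) = {B | IsFacet perles B ∧ ¬ IsSimplex B} := by
  ext B
  constructor
  · rintro ⟨j, rfl⟩
    exact ⟨isFacet_perles_iff.2 ⟨_, rfl⟩, not_isSimplex_perlesFacet j⟩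
  · rintro ⟨hB, hs⟩
    obtain ⟨j, rfl⟩ := isFacet_perles_iff.1 hB
    have hj : (j : ℕ) < 13 := by
      by_contra hcon
      exact hs (isSimplex_perlesFacet (Fin.le_def.2 (not_lt.1 hcon)))
    exact ⟨⟨j, hj⟩, rfl⟩

theorem perlesVertex_mem_perlesFace {i : Fin 12} {j : Fin 13} :
    perlesVertex i ∈ (perlesFace j).1 ↔ perlesIndex i j = 0 :=
  perlesVertex_mem_perlesFacet.trans (facetSlack_nonsimplicial j i)

/-! ### The flag -/

/-- Vertices of a triangular `9 × 9` submatrix of `S_F`. -/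
def flagVertex : Fin 9 → Fin 12 := ![5, 6, 7, 3, 0, 1, 11, 2, 4]

/-- Facets of a triangular `9 × 9` submatrix of `S_F`. -/
def flagFacet : Fin 9 → Fin 13 := ![0, 1, 2, 12, 4, 3, 5, 6, 7]

theorem flag_lower : ∀ p q : Fin 9, q < p → perlesIndex (flagVertex p) (flagFacet q) = 0 := by
  decide +kernel

theorem flag_diag : ∀ p : Fin 9, perlesIndex (flagVertex p) (flagFacet p) ≠ 0 := by
  decide +kernel

theorem containsFlag_perlesFace : ContainsFlag perles perlesFace := by
  -- Index `p` uses the first `9 - p` facets of the triangular submatrix, from all nine at `p = 0`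
  -- to none, giving `P`, at `p = 9`.
  let T : Fin 10 → Set (Fin 13) := fun p => {j | ∃ q : Fin 9, (q : ℕ) + p < 9 ∧ flagFacet q = j}
  let f : Fin (8 + 2) → Face perles := fun p => ⟨perles ∩ ⋂ j ∈ T p, (perlesFace j).1,
    isExposed_inter_biInter _ (fun j => (perlesFace j).2) _⟩
  have hf : StrictMono f := by
    rw [Fin.strictMono_iff_lt_succ]
    intro p
    have hp := p.2
    refine lt_of_le_not_ge ?_ fun h => ?_
    · refine inter_subset_inter_right _ (biInter_subset_biInter_left ?_)
      rintro _ ⟨q, hq, rfl⟩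
      exact ⟨q, by simp at hq ⊢; omega, rfl⟩
    -- The facet dropped at this step has index `8 - p`. Triangularity puts its diagonal vertex on
    -- all earlier facets but not on this one, so the inclusion is strict.
    · let q : Fin 9 := ⟨8 - p, by omega⟩
      have hmem : perlesVertex (flagVertex q) ∈ (f p.succ).1 := by
        refine ⟨perlesVertex_mem _, mem_iInter₂.2 ?_⟩
        rintro _ ⟨q', hq', rfl⟩
        refine perlesVertex_mem_perlesFace.2 (flag_lower _ _ (Fin.lt_def.2 ?_))
        simp [q] at hq' ⊢
        omega
      have h2 := (mem_iInter₂.1 (h hmem).2) (flagFacet q)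
        ⟨q, by simp [q]; omega, rfl⟩
      exact flag_diag q (perlesVertex_mem_perlesFace.1 h2)
  obtain ⟨c, hc⟩ := exists_flag_of_strictMono f hf
  refine ⟨c, fun B hB => ?_⟩
  obtain ⟨p, rfl⟩ := hc B hB
  exact ⟨T p, rfl⟩

/-! ### The symbolic slack matrix and the spanning forest -/

/-- The row of a variable of `S_F`. -/
def varRow : Fin 36 → Fin 12 :=
  ![0, 0, 0, 1, 1, 1, 1, 2, 2, 2, 3, 3, 3, 4, 4, 4, 5, 5, 5, 6, 6, 7, 7, 8, 8, 8, 9, 9, 9, 10, 10,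
    10, 11, 11, 11, 11]

/-- The column of a variable of `S_F`. -/
def varCol : Fin 36 → Fin 13 :=
  ![3, 4, 5, 3, 6, 7, 8, 6, 9, 10, 4, 11, 12, 7, 9, 11, 0, 10, 12, 1, 8, 2, 5, 0, 3, 7, 1, 4, 9, 2,
    6, 12, 5, 8, 10, 11]

theorem perlesIndex_var : ∀ n, perlesIndex (varRow n) (varCol n) = n := by decide +kernel

theorem var_perlesIndex : ∀ (j : Fin 13) (i : Fin 12) (n : Fin 36), perlesIndex i j = n →
    varRow n = i ∧ varCol n = j := by
  decide +kernel

theorem isSymbolicSlackMatrix_perlesSF (k : Type*) [Field k] :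
    IsSymbolicSlackMatrix perlesVertex (fun j => (perlesFace j).1)
      (perlesSF (MvPolynomial.X : Fin 36 → MvPolynomial (Fin 36) k)) := by
  refine ⟨fun i j h => perlesSF_eq_zero _ (perlesVertex_mem_perlesFace.1 h), ?_⟩
  have hne : ∀ n, perlesVertex (varRow n) ∉ (perlesFace (varCol n)).1 := fun n h => by
    rw [perlesVertex_mem_perlesFace, perlesIndex_var] at h
    exact WithZero.coe_ne_zero h
  let e : Fin 36 ≃ {p : Fin 12 × Fin 13 // perlesVertex p.1 ∉ (perlesFace p.2).1} :=
    Equiv.ofBijective (fun n => ⟨(varRow n, varCol n), hne n⟩) ⟨fun m n h => by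
      obtain ⟨h1, h2⟩ := Prod.mk.inj (Subtype.mk.inj h)
      have := perlesIndex_var m
      rw [h1, h2, perlesIndex_var] at this
      exact (WithZero.coe_inj.1 this).symm, fun ⟨⟨i, j⟩, h⟩ => by
      rw [perlesVertex_mem_perlesFace] at h
      obtain ⟨n, hn⟩ := WithZero.ne_zero_iff_exists.1 h
      obtain ⟨rfl, rfl⟩ := var_perlesIndex j i n hn.symm
      exact ⟨n, rfl⟩⟩
  refine ⟨e.symm, fun p => ?_⟩
  obtain ⟨n, rfl⟩ := e.surjective p
  rw [Equiv.symm_apply_apply]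
  exact perlesSF_of_index _ (perlesIndex_var n)

end SlackModel

/-! ### The spanning tree of the non-incidence graph. -/

namespace SlackModel
open Set

theorem perlesSF_eq_of_pattern {R : Type*} [Zero R] {S : Matrix (Fin 12) (Fin 13) R}
    (h : ∀ i j, perlesIndex i j = 0 → S i j = 0) :
    perlesSF (fun n => S (varRow n) (varCol n)) = S := by
  ext i j
  by_cases hij : perlesIndex i j = 0
  · rw [perlesSF_eq_zero _ hij, h i j hij]
  · obtain ⟨n, hn⟩ := WithZero.ne_zero_iff_exists.1 hij
    rw [perlesSF_of_index _ hn.symm, (var_perlesIndex j i n hn.symm).1,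
      (var_perlesIndex j i n hn.symm).2]

theorem perlesSF_var {R : Type*} [Zero R] (x : Fin 36 → R) (n : Fin 36) :
    perlesSF x (varRow n) (varCol n) = x n :=
  perlesSF_of_index x (perlesIndex_var n)

theorem perlesSF_scaledVar_eq_one_iff (k : Type*) [Field k] (i : Fin 12) (j : Fin 13) :
    perlesSF (scaledVar k) i j = 1 ↔ ∃ n ∈ perlesForest, varRow n = i ∧ varCol n = j := by
  constructor
  · intro h
    by_cases hij : perlesIndex i j = 0
    · rw [perlesSF_eq_zero _ hij] at h
      exact absurd h zero_ne_one
    · obtain ⟨n, hn⟩ := WithZero.ne_zero_iff_exists.1 hij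
      rw [perlesSF_of_index _ hn.symm] at h
      refine ⟨n, ?_, var_perlesIndex j i n hn.symm⟩
      by_contra hcon
      rw [scaledVar, dif_neg hcon] at h
      have := congrArg MvPolynomial.totalDegree h
      simp at this
  · rintro ⟨n, hn, rfl, rfl⟩
    rw [perlesSF_var, scaledVar_of_mem k hn]

theorem bipartiteGraph_mono {ι κ : Type*} {r s : ι → κ → Prop} (h : ∀ i j, r i j → s i j) :
    bipartiteGraph r ≤ bipartiteGraph s := by
  intro a b hab
  refine ⟨hab.1, hab.2.imp ?_ ?_⟩ <;>
  · rintro ⟨i, j, ha, hb, hr⟩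
    exact ⟨i, j, ha, hb, h i j hr⟩

theorem bipartiteGraph_adj {ι κ : Type*} {r : ι → κ → Prop} {i : ι} {j : κ} (h : r i j) :
    (bipartiteGraph r).Adj (Sum.inl i) (Sum.inr j) :=
  ⟨Sum.inl_ne_inr, Or.inl ⟨i, j, rfl, rfl, h⟩⟩

/-- Connectedness is shown by reaching every row `r` and column `c` from row 0; at most 24 edges on
25 nodes then leave no room for a cycle. -/
theorem isTree_perlesForest : (bipartiteGraph fun i j =>
    ∃ n ∈ perlesForest, varRow n = i ∧ varCol n = j).IsTree := by
  set T := bipartiteGraph fun i j => ∃ n ∈ perlesForest, varRow n = i ∧ varCol n = j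
  have hconn : T.Connected := by
    have e : ∀ n, n ∈ perlesForest → T.Reachable (Sum.inl (varRow n)) (Sum.inr (varCol n)) :=
      fun n hn => (bipartiteGraph_adj ⟨n, hn, rfl, rfl⟩).reachable
    have c3 : T.Reachable (Sum.inl 0) (Sum.inr 3) := e 0 (by decide)
    have r1 : T.Reachable (Sum.inl 0) (Sum.inl 1) := c3.trans (e 3 (by decide)).symm
    have c6 : T.Reachable (Sum.inl 0) (Sum.inr 6) := r1.trans (e 4 (by decide))
    have c7 : T.Reachable (Sum.inl 0) (Sum.inr 7) := r1.trans (e 5 (by decide))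
    have c8 : T.Reachable (Sum.inl 0) (Sum.inr 8) := r1.trans (e 6 (by decide))
    have r2 : T.Reachable (Sum.inl 0) (Sum.inl 2) := c6.trans (e 7 (by decide)).symm
    have c9 : T.Reachable (Sum.inl 0) (Sum.inr 9) := r2.trans (e 8 (by decide))
    have c10 : T.Reachable (Sum.inl 0) (Sum.inr 10) := r2.trans (e 9 (by decide))
    have r4 : T.Reachable (Sum.inl 0) (Sum.inl 4) := c9.trans (e 14 (by decide)).symm
    have c11 : T.Reachable (Sum.inl 0) (Sum.inr 11) := r4.trans (e 15 (by decide))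
    have r5 : T.Reachable (Sum.inl 0) (Sum.inl 5) := c10.trans (e 17 (by decide)).symm
    have c0 : T.Reachable (Sum.inl 0) (Sum.inr 0) := r5.trans (e 16 (by decide))
    have r6 : T.Reachable (Sum.inl 0) (Sum.inl 6) := c8.trans (e 20 (by decide)).symm
    have r8 : T.Reachable (Sum.inl 0) (Sum.inl 8) := c7.trans (e 25 (by decide)).symm
    have r9 : T.Reachable (Sum.inl 0) (Sum.inl 9) := c9.trans (e 28 (by decide)).symm
    have c1 : T.Reachable (Sum.inl 0) (Sum.inr 1) := r9.trans (e 26 (by decide))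
    have c4 : T.Reachable (Sum.inl 0) (Sum.inr 4) := r9.trans (e 27 (by decide))
    have r10 : T.Reachable (Sum.inl 0) (Sum.inl 10) := c6.trans (e 30 (by decide)).symm
    have c2 : T.Reachable (Sum.inl 0) (Sum.inr 2) := r10.trans (e 29 (by decide))
    have c12 : T.Reachable (Sum.inl 0) (Sum.inr 12) := r10.trans (e 31 (by decide))
    have r3 : T.Reachable (Sum.inl 0) (Sum.inl 3) := c12.trans (e 12 (by decide)).symm
    have r7 : T.Reachable (Sum.inl 0) (Sum.inl 7) := c2.trans (e 21 (by decide)).symm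
    have r11 : T.Reachable (Sum.inl 0) (Sum.inl 11) := c10.trans (e 34 (by decide)).symm
    have c5 : T.Reachable (Sum.inl 0) (Sum.inr 5) := r11.trans (e 32 (by decide))
    have hroot : ∀ x, T.Reachable (Sum.inl 0) x := by
      rintro (i | j)
      · fin_cases i
        exacts [.refl _, r1, r2, r3, r4, r5, r6, r7, r8, r9, r10, r11]
      · fin_cases j
        exacts [c0, c1, c2, c3, c4, c5, c6, c7, c8, c9, c10, c11, c12]
    exact SimpleGraph.connected_iff_exists_forall_reachable _ |>.2 ⟨_, hroot⟩
  refine SimpleGraph.isTree_iff_connected_and_card.2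
    ⟨hconn, le_antisymm ?_ hconn.card_vert_le_card_edgeSet_add_one⟩
  have hsub : T.edgeSet ⊆
      (perlesForest.image fun n => s(Sum.inl (varRow n), Sum.inr (varCol n)) :
        Finset (Sym2 (Fin 12 ⊕ Fin 13))) := by
    intro e
    induction e using Sym2.ind with
    | _ a b =>
      rintro ⟨-, ⟨i, j, rfl, rfl, n, hn, rfl, rfl⟩ | ⟨i, j, rfl, rfl, n, hn, rfl, rfl⟩⟩
      · exact Finset.mem_coe.2 (Finset.mem_image_of_mem _ hn)
      · rw [Sym2.eq_swap]
        exact Finset.mem_coe.2 (Finset.mem_image_of_mem _ hn)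
  have hcard := Set.ncard_le_ncard hsub (Finset.finite_toSet _)
  rw [Set.ncard_coe_finset] at hcard
  have h24 : perlesForest.card = 24 := by decide
  have := Finset.card_image_le (s := perlesForest)
    (f := fun n => (s(Sum.inl (varRow n), Sum.inr (varCol n)) : Sym2 (Fin 12 ⊕ Fin 13)))
  rw [Nat.card_coe_set_eq, Nat.card_eq_fintype_card, Fintype.card_sum, Fintype.card_fin,
    Fintype.card_fin]
  omega

theorem isMaximalForest_perles (k : Type*) [Field k] :
    IsMaximalForest (nonIncidenceGraph perlesVertex fun j => (perlesFace j).1)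
      (bipartiteGraph fun i j => perlesSF (scaledVar k) i j = 1) := by
  simp only [perlesSF_scaledVar_eq_one_iff]
  have hle : (bipartiteGraph fun i j => ∃ n ∈ perlesForest, varRow n = i ∧ varCol n = j) ≤
      nonIncidenceGraph perlesVertex fun j => (perlesFace j).1 := by
    refine bipartiteGraph_mono ?_
    rintro _ _ ⟨n, -, rfl, rfl⟩ h
    rw [perlesVertex_mem_perlesFace, perlesIndex_var] at h
    exact WithZero.coe_ne_zero h
  exact ((isTree_perlesForest.connected.mono hle).maximal_le_isAcyclic_iff_isTree hle).2
    isTree_perlesForest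

/-! ### Scaling slack matrices -/

/-- The rows and columns of a matrix can be scaled so that the entries of the forest become one. -/
theorem exists_scaling {K : Type*} [Field K] (p : K → Prop) (h1 : p 1)
    (hmul : ∀ u v, p u → p v → p (u * v)) (hinv : ∀ u, p u → p u⁻¹) (hne : ∀ u, p u → u ≠ 0)
    (S : Matrix (Fin 12) (Fin 13) K) (hS : ∀ n, p (S (varRow n) (varCol n))) :
    ∃ (r : Fin 12 → K) (c : Fin 13 → K), (∀ i, p (r i)) ∧ (∀ j, p (c j)) ∧
      ∀ n ∈ perlesForest, r (varRow n) * S (varRow n) (varCol n) * c (varCol n) = 1 := by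
  have row : ∀ n c, p c → ∃ r, p r ∧ r * S (varRow n) (varCol n) * c = 1 := fun n c hc =>
    ⟨(S (varRow n) (varCol n) * c)⁻¹, hinv _ (hmul _ _ (hS n) hc), by
      rw [mul_assoc, inv_mul_cancel₀ (hne _ (hmul _ _ (hS n) hc))]⟩
  have col : ∀ n r, p r → ∃ c, p c ∧ r * S (varRow n) (varCol n) * c = 1 := fun n r hr =>
    ⟨(r * S (varRow n) (varCol n))⁻¹, hinv _ (hmul _ _ hr (hS n)),
      mul_inv_cancel₀ (hne _ (hmul _ _ hr (hS n)))⟩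
  -- The tree is traversed from row 0, whose factor is one; each edge fixes the factor at its new
  -- endpoint. The predicate `p` covers both positive reals and nonzero rationals.
  obtain ⟨c3, pc3, e0⟩ := col 0 1 h1
  obtain ⟨r1, pr1, e3⟩ := row 3 c3 pc3
  obtain ⟨c6, pc6, e4⟩ := col 4 r1 pr1
  obtain ⟨c7, pc7, e5⟩ := col 5 r1 pr1
  obtain ⟨c8, pc8, e6⟩ := col 6 r1 pr1
  obtain ⟨r2, pr2, e7⟩ := row 7 c6 pc6
  obtain ⟨c9, pc9, e8⟩ := col 8 r2 pr2
  obtain ⟨c10, pc10, e9⟩ := col 9 r2 pr2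
  obtain ⟨r4, pr4, e14⟩ := row 14 c9 pc9
  obtain ⟨c11, pc11, e15⟩ := col 15 r4 pr4
  obtain ⟨r5, pr5, e17⟩ := row 17 c10 pc10
  obtain ⟨c0, pc0, e16⟩ := col 16 r5 pr5
  obtain ⟨r6, pr6, e20⟩ := row 20 c8 pc8
  obtain ⟨r8, pr8, e25⟩ := row 25 c7 pc7
  obtain ⟨r9, pr9, e28⟩ := row 28 c9 pc9
  obtain ⟨c1, pc1, e26⟩ := col 26 r9 pr9
  obtain ⟨c4, pc4, e27⟩ := col 27 r9 pr9
  obtain ⟨r10, pr10, e30⟩ := row 30 c6 pc6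
  obtain ⟨c2, pc2, e29⟩ := col 29 r10 pr10
  obtain ⟨c12, pc12, e31⟩ := col 31 r10 pr10
  obtain ⟨r3, pr3, e12⟩ := row 12 c12 pc12
  obtain ⟨r7, pr7, e21⟩ := row 21 c2 pc2
  obtain ⟨r11, pr11, e34⟩ := row 34 c10 pc10
  obtain ⟨c5, pc5, e32⟩ := col 32 r11 pr11
  refine ⟨![1, r1, r2, r3, r4, r5, r6, r7, r8, r9, r10, r11],
    ![c0, c1, c2, c3, c4, c5, c6, c7, c8, c9, c10, c11, c12], ?_, ?_, ?_⟩
  · intro i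
    fin_cases i
    exacts [h1, pr1, pr2, pr3, pr4, pr5, pr6, pr7, pr8, pr9, pr10, pr11]
  · intro j
    fin_cases j
    exacts [pc0, pc1, pc2, pc3, pc4, pc5, pc6, pc7, pc8, pc9, pc10, pc11, pc12]
  · simp only [perlesForest, Finset.mem_insert, Finset.mem_singleton, forall_eq_or_imp, forall_eq]
    exact ⟨e0, e3, e4, e5, e6, e7, e8, e9, e12, e14, e15, e16, e17, e20, e21, e25, e26, e27, e28,
      e29, e30, e31, e32, e34⟩

theorem det_mul_eq_zero_of_card {R m : Type*} [CommRing R] [Fintype m] {n : ℕ}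
    (hm : Fintype.card m = n) (A : Matrix (Fin (n + 1)) m R) (B : Matrix m (Fin (n + 1)) R) :
    (A * B).det = 0 := by
  let e : Fin n ≃ m := (Fintype.equivFinOfCardEq hm).symm
  have h : A * B = A.submatrix id e * B.submatrix e id := by
    rw [Matrix.submatrix_mul_equiv, Matrix.submatrix_id_id]
  rw [h]
  exact det_mul_eq_zero_of_lt _ _

/-- A matrix of the shape `S_F` with the forest scaled to one and of rank at most nine is
determined by its last variable, which is a root of `t² + t = 1`. -/
theorem eq_perlesPoint_of_factorization {K m : Type*} [Field K] [Fintype m]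
    (hm : Fintype.card m = 9) {a : Fin 36 → K} (ha : ∀ n ∈ perlesForest, a n = 1)
    (hne : ∀ n, a n ≠ 0) (A : Matrix (Fin 12) m K) (B : Matrix m (Fin 13) K)
    (h : perlesSF a = A * B) : a = perlesPoint (a 35) ∧ a 35 ^ 2 + a 35 = 1 := by
  refine eq_perlesPoint ha (perlesGenerators_eq_zero a ha (fun n => (hne n).isUnit) ?_)
  intro r c
  rw [h, Matrix.submatrix_mul _ _ r id c Function.bijective_id]
  exact det_mul_eq_zero_of_card hm _ _

theorem scale_factorization {K m : Type*} [Field K] [Fintype m] (r : Fin 12 → K) (c : Fin 13 → K)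
    {A : Matrix (Fin 12) m K} {B : Matrix m (Fin 13) K} {S : Matrix (Fin 12) (Fin 13) K}
    (h : S = A * B) {a : Fin 36 → K} (ha : ∀ i j, r i * S i j * c j = perlesSF a i j) :
    perlesSF a = Matrix.diagonal r * A * (B * Matrix.diagonal c) := by
  ext i j
  rw [← ha, h, ← Matrix.mul_assoc, Matrix.mul_diagonal, Matrix.mul_assoc, Matrix.diagonal_mul]

/-- The matrix of homogenized points. -/
def homogMatrix {d : ℕ} {ι : Type*} (w : ι → Fin d → ℝ) : Matrix ι (Fin d ⊕ Unit) ℝ :=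
  Matrix.of fun i => homog (w i)

theorem IsSlackMatrix.exists_factorization {d : ℕ} {ι κ : Type*} {Q : Set (Fin d → ℝ)}
    {w : ι → Fin d → ℝ} {F : κ → Set (Fin d → ℝ)} {S : Matrix ι κ ℝ} (h : IsSlackMatrix Q w F S) :
    ∃ B : Matrix (Fin d ⊕ Unit) κ ℝ, S = homogMatrix w * B := by
  obtain ⟨b, α, -, -, hS⟩ := h
  refine ⟨Matrix.of fun l j => Sum.elim (fun k => - α j k) (fun _ => b j) l, ?_⟩
  ext i j
  rw [Matrix.mul_apply]
  simp [hS, homogMatrix, homog, dotProduct, mul_comm]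
  ring

/-! ### Normal form of the slack matrices of a realization. -/

section Realization

variable {Q : Set (Fin 8 → ℝ)} {w : Fin 12 → Fin 8 → ℝ} {F : Fin 13 → Set (Fin 8 → ℝ)}
  {S : Matrix (Fin 12) (Fin 13) ℝ}

theorem IsSlackMatrix.eq_zero_iff (h : IsSlackMatrix Q w F S) (hw : ∀ i, w i ∈ Q)
    (hF : ∀ i j, w i ∈ F j ↔ perlesIndex i j = 0) (i : Fin 12) (j : Fin 13) :
    S i j = 0 ↔ perlesIndex i j = 0 := by
  obtain ⟨b, α, -, h2, hS⟩ := h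
  rw [← hF, h2, hS]
  exact (and_iff_right (hw i)).symm

theorem IsSlackMatrix.pos (h : IsSlackMatrix Q w F S) (hw : ∀ i, w i ∈ Q)
    (hF : ∀ i j, w i ∈ F j ↔ perlesIndex i j = 0) (n : Fin 36) :
    0 < S (varRow n) (varCol n) := by
  refine lt_of_le_of_ne ?_ fun h0 => ?_
  · obtain ⟨b, α, h1, -, hS⟩ := h
    rw [hS]
    exact h1 _ _ (hw _)
  · rw [eq_comm, h.eq_zero_iff hw hF, perlesIndex_var] at h0
    exact WithZero.coe_ne_zero h0

theorem IsSlackMatrix.exists_pos_scaling (h : IsSlackMatrix Q w F S) (hw : ∀ i, w i ∈ Q)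
    (hF : ∀ i j, w i ∈ F j ↔ perlesIndex i j = 0) :
    ∃ (r : Fin 12 → ℝ) (c : Fin 13 → ℝ) (a : Fin 36 → ℝ),
      (∀ i, 0 < r i) ∧ (∀ j, 0 < c j) ∧ (∀ n ∈ perlesForest, a n = 1) ∧
      ∀ i j, r i * S i j * c j = perlesSF a i j := by
  obtain ⟨r, c, hr, hc, hf⟩ := exists_scaling (fun u : ℝ => 0 < u) one_pos
    (fun _ _ => mul_pos) (fun _ => inv_pos.2) (fun _ => ne_of_gt) S (h.pos hw hF)
  refine ⟨r, c, _, hr, hc, hf, fun i j => ?_⟩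
  exact (congrFun₂ (perlesSF_eq_of_pattern (S := Matrix.of fun i j => r i * S i j * c j)
    fun i j hij => by simp [(h.eq_zero_iff hw hF i j).2 hij]) i j).symm

theorem IsSlackMatrix.scaled_eq (h : IsSlackMatrix Q w F S) (hw : ∀ i, w i ∈ Q)
    (hF : ∀ i j, w i ∈ F j ↔ perlesIndex i j = 0) {r : Fin 12 → ℝ} {c : Fin 13 → ℝ}
    {a : Fin 36 → ℝ} (hr : ∀ i, r i ≠ 0) (hc : ∀ j, c j ≠ 0) (ha : ∀ n ∈ perlesForest, a n = 1)
    (hS : ∀ i j, r i * S i j * c j = perlesSF a i j) :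
    a = perlesPoint (a 35) ∧ a 35 ^ 2 + a 35 = 1 := by
  obtain ⟨B, hB⟩ := h.exists_factorization
  refine eq_perlesPoint_of_factorization (by simp) ha (fun n => ?_) _ _
    (scale_factorization r c hB hS)
  rw [← perlesSF_var a n, ← hS]
  exact mul_ne_zero (mul_ne_zero (hr _) (h.pos hw hF n).ne') (hc _)

/-- After positive scaling, the slack matrix is the same for all realizations. -/
theorem IsSlackMatrix.exists_normalForm (h : IsSlackMatrix Q w F S) (hw : ∀ i, w i ∈ Q)
    (hF : ∀ i j, w i ∈ F j ↔ perlesIndex i j = 0) :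
    ∃ (r : Fin 12 → ℝ) (B : Matrix (Fin 8 ⊕ Unit) (Fin 13) ℝ), (∀ i, 0 < r i) ∧
      perlesSF (perlesPoint ((-1 + √5) / 2)) = Matrix.diagonal r * homogMatrix w * B := by
  obtain ⟨r, c, a, hr, hc, ha, hS⟩ := h.exists_pos_scaling hw hF
  obtain ⟨h1, h2⟩ := h.scaled_eq hw hF (fun i => (hr i).ne') (fun j => (hc j).ne') ha hS
  have hpos : 0 < a 35 := by
    rw [← perlesSF_var a 35, ← hS]
    exact mul_pos (mul_pos (hr _) (h.pos hw hF 35)) (hc _)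
  have h35 : a 35 = (-1 + √5) / 2 := by
    -- Positive scaling keeps the entry positive, which excludes the negative root.
    refine ((sq_add_self_eq_one_iff (Real.sq_sqrt (by norm_num))).1 h2).resolve_right fun h => ?_
    have := Real.sqrt_nonneg 5
    linarith
  obtain ⟨B, hB⟩ := h.exists_factorization
  refine ⟨r, B * Matrix.diagonal c, hr, ?_⟩
  rw [← h35, ← h1]
  exact scale_factorization r c hB hS

theorem det_flag_ne_zero {a : Fin 36 → ℝ} (ha : ∀ n, a n ≠ 0) :
    ((perlesSF a).submatrix flagVertex flagFacet).det ≠ 0 := by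
  rw [Matrix.det_of_isUpperTriangular]
  · refine Finset.prod_ne_zero_iff.2 fun p _ => ?_
    obtain ⟨n, hn⟩ := WithZero.ne_zero_iff_exists.1 (flag_diag p)
    rw [Matrix.submatrix_apply, perlesSF_of_index a hn.symm]
    exact ha n
  · intro p q hqp
    exact perlesSF_eq_zero a (flag_lower p q hqp)

end Realization

/-! ### Projective uniqueness and irrationality. -/

theorem isProjectivelyUnique_perles : IsProjectivelyUnique perles := by
  rintro Q hQ ⟨e⟩
  obtain ⟨w, -, hwQ, hwe⟩ := exists_vertices_of_orderIso isPolytope_perles hQ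
    perlesVertex_injective range_perlesVertex e
  have hw : ∀ i, w i ∈ Q := fun i =>
    extremePoints_subset (𝕜 := ℝ) (hwQ ▸ mem_range_self i)
  obtain ⟨S, hS⟩ := exists_isSlackMatrix w fun j => e (perlesFace j)
  obtain ⟨S', hS'⟩ := exists_isSlackMatrix perlesVertex perlesFace
  obtain ⟨r, B, hr, hB⟩ := hS.exists_normalForm hw fun i j =>
    (hwe i _).trans perlesVertex_mem_perlesFace
  obtain ⟨p, B', hp, hB'⟩ := hS'.exists_normalForm perlesVertex_mem fun i j =>
    perlesVertex_mem_perlesFace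
  have h5 : √5 ^ 2 = 5 := Real.sq_sqrt (by norm_num)
  set a : Fin 36 → ℝ := perlesPoint ((-1 + √5) / 2)
  have ha : ∀ n, a n ≠ 0 := fun n =>
    (isUnit_perlesPoint (by linear_combination h5 / 4) n).ne_zero
  let ε : Fin 8 ⊕ Unit ≃ Fin 9 := Fintype.equivFinOfCardEq (by simp)
  -- The right factor, restricted to the nine flag columns, is square and divides the nonzero
  -- triangular minor; so it is invertible.
  have hdet : ∀ (u : Fin 12 → ℝ) (x : Fin 12 → Fin 8 → ℝ) (N : Matrix (Fin 8 ⊕ Unit) (Fin 13) ℝ),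
      perlesSF a = Matrix.diagonal u * homogMatrix x * N →
      IsUnit (N.submatrix id (flagFacet ∘ ε)).det := by
    intro u x N h
    have h1 := det_flag_ne_zero ha
    rw [← Matrix.det_submatrix_equiv_self ε, Matrix.submatrix_submatrix, h,
      Matrix.submatrix_mul _ _ _ id _ Function.bijective_id, Matrix.det_mul] at h1
    exact (right_ne_zero_of_mul h1).isUnit
  have hdB := hdet _ _ _ hB
  have hdB' := hdet _ _ _ hB'
  set N := B.submatrix id (flagFacet ∘ ε)
  set N' := B'.submatrix id (flagFacet ∘ ε)
  have hN : Matrix.diagonal r * homogMatrix w * N =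
      Matrix.diagonal p * homogMatrix perlesVertex * N' := by
    have h1 := congrArg (Matrix.submatrix · id (flagFacet ∘ ε)) (hB.symm.trans hB')
    simp only [Matrix.submatrix_mul _ _ id id _ Function.bijective_id, Matrix.submatrix_id_id] at h1
    exact h1
  have hH : Matrix.diagonal r * homogMatrix w =
      Matrix.diagonal p * homogMatrix perlesVertex * (N' * N⁻¹) := by
    rw [← Matrix.mul_assoc, ← hN, Matrix.mul_assoc _ N, Matrix.mul_nonsing_inv _ hdB,
      Matrix.mul_one]
  have hQc : Q = convexHull ℝ (range w) := by rw [hwQ]; exact hQ.eq_convexHull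
  rw [hQc]
  refine projEquiv_of_mulVec (N' * N⁻¹).transpose ?_ (μ := fun i => r i / p i)
    (fun i => div_pos (hr i) (hp i)) fun i => ?_
  · rw [Matrix.det_transpose, Matrix.det_mul]
    exact hdB'.mul (Matrix.isUnit_nonsing_inv_det _ hdB)
  · funext l
    have h1 := congrFun₂ hH i l
    rw [Matrix.diagonal_mul, Matrix.mul_assoc, Matrix.diagonal_mul] at h1
    have h2 : (homogMatrix perlesVertex * (N' * N⁻¹)) i l =
        (N' * N⁻¹).transpose.mulVec (homog (perlesVertex i)) l := by
      rw [Matrix.mul_apply]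
      exact Finset.sum_congr rfl fun t _ => mul_comm _ _
    rw [← h2, Pi.smul_apply, smul_eq_mul, div_mul_eq_mul_div, eq_div_iff (hp i).ne', mul_comm]
    exact h1.symm

theorem rat_sq_add_self_ne_one (q : ℚ) : q ^ 2 + q ≠ 1 := by
  intro h
  have h1 : (q : ℝ) ^ 2 + q = 1 := by exact_mod_cast h
  have hirr : Irrational √5 := by
    simpa using (show Nat.Prime 5 by norm_num).irrational_sqrt
  rcases (sq_add_self_eq_one_iff (Real.sq_sqrt (by norm_num : (0 : ℝ) ≤ 5))).1 h1 with h2 | h2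
  · exact hirr ⟨2 * q + 1, by push_cast; linarith⟩
  · exact hirr ⟨-2 * q - 1, by push_cast; linarith⟩

theorem not_exists_rational_realization :
    ¬ ∃ Q : Set (Fin 8 → ℝ), IsPolytope Q ∧ CombEquiv perles Q ∧ IsRational Q := by
  rintro ⟨Q, hQ, ⟨e⟩, hrat⟩
  obtain ⟨w, -, hwQ, hwe⟩ := exists_vertices_of_orderIso isPolytope_perles hQ
    perlesVertex_injective range_perlesVertex e
  have hwx : ∀ i, w i ∈ Q.extremePoints ℝ := fun i => hwQ ▸ mem_range_self i
  have hw : ∀ i, w i ∈ Q := fun i => extremePoints_subset (hwx i)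
  obtain ⟨S, hS⟩ := exists_isSlackMatrix w fun j => e (perlesFace j)
  have hF : ∀ i j, w i ∈ (e (perlesFace j)).1 ↔ perlesIndex i j = 0 := fun i j =>
    (hwe i _).trans perlesVertex_mem_perlesFace
  choose q hq using fun i => hrat (w i) (hwx i)
  -- The facet equations may have irrational coefficients even if the vertices are rational. A
  -- ℚ-linear functional on `ℝ`, nonzero at the 36 nonzero slacks, makes them rational without
  -- changing the support.
  obtain ⟨f, hf⟩ := Module.exists_dual_forall_apply_ne_zero (K := ℚ)
    (fun n => S (varRow n) (varCol n)) fun n => (hS.pos hw hF n).ne'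
  have hzero : ∀ i j, perlesIndex i j = 0 → f (S i j) = 0 := fun i j hij => by
    rw [(hS.eq_zero_iff hw hF i j).2 hij, map_zero]
  obtain ⟨b, α, -, -, hSe⟩ := hS
  let S' : Matrix (Fin 12) (Fin 13) ℚ := Matrix.of fun i j => f (S i j)
  obtain ⟨X, N, hfac⟩ : ∃ (X : Matrix (Fin 12) (Fin 8 ⊕ Unit) ℚ)
      (N : Matrix (Fin 8 ⊕ Unit) (Fin 13) ℚ), S' = X * N := by
    refine ⟨Matrix.of fun i => Sum.elim (q i) fun _ => 1,
      Matrix.of fun l j => Sum.elim (fun k => - f (α j k)) (fun _ => f (b j)) l, ?_⟩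
    ext i j
    rw [Matrix.mul_apply]
    -- Vertex coordinates are rational scalars, so `f` passes through them and the factorization
    -- through dimension nine survives.
    have h1 : ∀ k, f (α j k * w i k) = q i k * f (α j k) := fun k => by
      rw [hq, mul_comm, ← smul_eq_mul (q i k), ← map_smul, Rat.smul_def]
    simp [S', hSe, dotProduct, h1]
    ring
  obtain ⟨r, c, hr, hc, h1⟩ := exists_scaling (fun u : ℚ => u ≠ 0) one_ne_zero
    (fun _ _ => mul_ne_zero) (fun _ => inv_ne_zero) (fun _ => id) S' hf
  have hsc : ∀ i j, r i * S' i j * c j =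
      perlesSF (fun n => r (varRow n) * S' (varRow n) (varCol n) * c (varCol n)) i j := fun i j =>
    (congrFun₂ (perlesSF_eq_of_pattern (S := Matrix.of fun i j => r i * S' i j * c j)
      fun i j hij => by simp [S', hzero i j hij]) i j).symm
  exact rat_sq_add_self_ne_one _ (eq_perlesPoint_of_factorization (by simp) h1
    (fun n => mul_ne_zero (mul_ne_zero (hr _) (hf n)) (hc _)) _ _
    (scale_factorization r c hfac hsc)).2

end SlackModel

open SlackModel in
theorem mainTheorem2 (k : Type*) [Field k] :
    -- `P` is a projectively unique 8-polytope with 12 vertices and 34 facets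
    IsPolytope perles ∧ affineSpan ℝ perles = ⊤ ∧
    Function.Injective perlesVertex ∧ Set.range perlesVertex = perles.extremePoints ℝ ∧
    {B | IsFacet perles B}.ncard = 34 ∧
    IsProjectivelyUnique perles ∧
    -- its symbolic slack matrix has 120 variables
    {p : (Fin 8 → ℝ) × Set (Fin 8 → ℝ) |
      p.1 ∈ perles.extremePoints ℝ ∧ IsFacet perles p.2 ∧ p.1 ∉ p.2}.ncard = 120 ∧
    -- the 13 nonsimplicial facets contain a flag and give the reduced symbolic slack matrix
    (∃ F : Fin 13 → Face perles,
      Function.Injective F ∧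
      Set.range (fun j => (F j).1) = {B | IsFacet perles B ∧ ¬ IsSimplex B} ∧
      ContainsFlag perles F ∧
      IsSymbolicSlackMatrix perlesVertex (fun j => (F j).1)
        (perlesSF (MvPolynomial.X : Fin 36 → MvPolynomial (Fin 36) k)) ∧
      -- the entries set to one form a maximal spanning forest of the non-incidence graph
      IsMaximalForest (nonIncidenceGraph perlesVertex fun j => (F j).1)
        (bipartiteGraph fun i j => perlesSF (scaledVar k) i j = 1) ∧
      -- every scaled reduced slack matrix of every realization `Q` has an entry `(-1 ± √5) / 2`
      ∀ Q : Set (Fin 8 → ℝ), IsPolytope Q → ∀ e : Face perles ≃o Face Q,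
        ∃ w : Fin 12 → Fin 8 → ℝ, Function.Injective w ∧ Set.range w = Q.extremePoints ℝ ∧
          (∀ i (A : Face perles), w i ∈ (e A).1 ↔ perlesVertex i ∈ A.1) ∧
          (∃ S, IsSlackMatrix Q w (fun j => (e (F j)).1) S) ∧
          ∀ S, IsSlackMatrix Q w (fun j => (e (F j)).1) S →
            (∃ (r : Fin 12 → ℝ) (c : Fin 13 → ℝ) (a : Fin 36 → ℝ),
              (∀ i, 0 < r i) ∧ (∀ j, 0 < c j) ∧ (∀ n ∈ perlesForest, a n = 1) ∧
              ∀ i j, r i * S i j * c j = perlesSF a i j) ∧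
            ∀ (r : Fin 12 → ℝ) (c : Fin 13 → ℝ) (a : Fin 36 → ℝ),
              (∀ i, r i ≠ 0) → (∀ j, c j ≠ 0) → (∀ n ∈ perlesForest, a n = 1) →
              (∀ i j, r i * S i j * c j = perlesSF a i j) →
              a 35 = (-1 + √5) / 2 ∨ a 35 = (-1 - √5) / 2) ∧
    -- the scaled reduced slack ideal
    perlesIdeal k = Ideal.span (perlesGenerators (scaledVar k)) ∧
    (∀ a ∈ MvPolynomial.zeroLocus ℂ (perlesIdeal ℂ),
      a ⟨35, by decide⟩ = (-1 + (√5 : ℝ)) / 2 ∨ a ⟨35, by decide⟩ = (-1 - (√5 : ℝ)) / 2) ∧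
    -- there is no rational realization
    ¬ ∃ Q : Set (Fin 8 → ℝ), IsPolytope Q ∧ CombEquiv perles Q ∧ IsRational Q := by
  refine ⟨isPolytope_perles, affineSpan_perles, perlesVertex_injective, range_perlesVertex,
    ncard_facets, isProjectivelyUnique_perles, ncard_nonincident, ?_, perlesIdeal_eq k,
    fun a ha => mem_zeroLocus_perlesIdeal ha, not_exists_rational_realization⟩
  refine ⟨perlesFace, perlesFace_injective, range_perlesFace, containsFlag_perlesFace,
    isSymbolicSlackMatrix_perlesSF k, isMaximalForest_perles k, fun Q hQ e => ?_⟩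
  obtain ⟨w, hwi, hwQ, hwe⟩ := exists_vertices_of_orderIso isPolytope_perles hQ
    perlesVertex_injective range_perlesVertex e
  have hw : ∀ i, w i ∈ Q := fun i =>
    extremePoints_subset (𝕜 := ℝ) (hwQ ▸ Set.mem_range_self i)
  have hF : ∀ i j, w i ∈ (e (perlesFace j)).1 ↔ perlesIndex i j = 0 := fun i j =>
    (hwe i _).trans perlesVertex_mem_perlesFace
  refine ⟨w, hwi, hwQ, hwe, exists_isSlackMatrix w _, fun S hS =>
    ⟨hS.exists_pos_scaling hw hF, fun r c a hr hc ha hrc => ?_⟩⟩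
  exact (sq_add_self_eq_one_iff (Real.sq_sqrt (by norm_num))).1 (hS.scaled_eq hw hF hr hc ha hrc).2
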